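/- For a finite graph $G$ with vertex set $\{1,\dots,n\}$ and a real number $p\ge 1$, let \[ \lambda^{(p)}(G)=\max\Big\{2\sum_{\{i,j\}\in E(G)}x_ix_j \;:\; x_1,\dots,x_n\in\mathbb{R},\ |x_1|^p+\cdots+|x_n|^p=1\Big\} \] be its $p$-spectral radius. Let $T_r(n)$ be the Turán graph, i.e. the complete $r$-partite graph of order $n$ with parts of size $\lfloor n/r\rfloor$ or $\lceil n/r\rceil$. For integers $r\ge 2$ and $t\ge 2$ let $K_r^+(t)$ be the complete $r$-partite graph with each part of size $t$, with one edge added to its first part. Let $\log$ denote the natural logarithm. Theorem. Let $r$ and $n$ be positive integers and let $p$ and $c$ be real numbers satisfying \[ r\ge 2,\qquad p>1,\qquad 0<c\le \tfrac12\, r^{-(r+8)r},\qquad \log n\ge \frac{2p}{c(p-1)} . \] If $G$ is a graph of order $n$ with $\lambda^{(p)}(G)>\lambda^{(p)}(T_r(n))$, then $G$ contains $K_r^+(\lfloor c\log n\rfloor)$ as a (not necessarily induced) subgraph. (The assumptions imply $\lfloor c\log n\rfloor\ge 2$.) -/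

import Mathlib

/-- The quadratic form `P_G(x) = 2 ∑_{ {i,j} ∈ E(G) } x i * x j` of a finite graph `G`. -/
noncomputable def graphForm {V : Type*} [Fintype V] (G : SimpleGraph V) (x : V → ℝ) : ℝ :=
  open Classical in
  2 * ∑ e ∈ G.edgeFinset, Sym2.lift ⟨fun i j => x i * x j, fun i j => mul_comm (x i) (x j)⟩ e

/-- The values of the quadratic form of `G` on the vectors `x` with `∑ |x i| ^ p = 1`. -/
def pSphereValues {V : Type*} [Fintype V] (p : ℝ) (G : SimpleGraph V) : Set ℝ :=
  {y | ∃ x : V → ℝ, ∑ i, |x i| ^ p = 1 ∧ graphForm G x = y}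

/-- The `p`-spectral radius of a finite graph. The supremum is a maximum if `p ≥ 1` and the
vertex set is nonempty, see `isGreatest_pSpectralRadius`. -/
noncomputable def pSpectralRadius {V : Type*} [Fintype V] (p : ℝ) (G : SimpleGraph V) : ℝ :=
  sSup (pSphereValues p G)

theorem isGreatest_pSpectralRadius {V : Type*} [Fintype V] [Nonempty V] {p : ℝ} (hp : 1 ≤ p)
    (G : SimpleGraph V) : IsGreatest (pSphereValues p G) (pSpectralRadius p G) := by
  classical
  have hp0 : 0 < p := by linarith
  have himg : pSphereValues p G = graphForm G '' {x : V → ℝ | ∑ i, |x i| ^ p = 1} := rfl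
  have hcont : Continuous (graphForm G) := by
    unfold graphForm
    refine continuous_const.mul (continuous_finsetSum _ fun e _ => ?_)
    induction e using Sym2.ind with
    | _ i j => simp only [Sym2.lift_mk]; fun_prop
  have hclosed : IsClosed {x : V → ℝ | ∑ i, |x i| ^ p = 1} := by
    refine isClosed_eq (continuous_finsetSum _ fun i _ => ?_) continuous_const
    exact (continuous_apply i).abs.rpow_const fun _ => Or.inr hp0.le
  have hsub : {x : V → ℝ | ∑ i, |x i| ^ p = 1} ⊆ Set.Icc (fun _ => -1) (fun _ => 1) := by
    intro x hx
    have h : ∀ i, |x i| ≤ 1 := by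
      intro i
      have h1 : |x i| ^ p ≤ 1 := by
        rw [← (show ∑ i, |x i| ^ p = 1 from hx)]
        exact Finset.single_le_sum (f := fun i => |x i| ^ p)
          (fun j _ => Real.rpow_nonneg (abs_nonneg _) _) (Finset.mem_univ i)
      by_contra hlt
      exact absurd (Real.one_lt_rpow (not_le.mp hlt) hp0) (not_lt.mpr h1)
    exact ⟨fun i => (abs_le.mp (h i)).1, fun i => (abs_le.mp (h i)).2⟩
  have hcompact : IsCompact {x : V → ℝ | ∑ i, |x i| ^ p = 1} :=
    isCompact_Icc.of_isClosed_subset hclosed hsub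
  have hne : {x : V → ℝ | ∑ i, |x i| ^ p = 1}.Nonempty := by
    obtain ⟨v⟩ := ‹Nonempty V›
    refine ⟨Pi.single v 1, ?_⟩
    rw [Set.mem_ofPred_eq, Finset.sum_eq_single v]
    · simp
    · intro b _ hb
      simp [Pi.single_eq_of_ne hb, Real.zero_rpow hp0.ne']
    · simp
  rw [pSpectralRadius, himg]
  exact (hcompact.image hcont).isGreatest_sSup (hne.image _)

/-- For `r ≥ 1` and `t ≥ 2`: the complete `r`-partite graph with parts `{i} × Fin t` of size `t`,
with one edge, from `(0, 0)` to `(0, 1)`, added to its first part. -/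
def completeEquipartitePlus (r t : ℕ) : SimpleGraph (Fin r × Fin t) :=
  SimpleGraph.completeEquipartiteGraph r t ⊔
    SimpleGraph.fromRel fun v w =>
      (v.1 : ℕ) = 0 ∧ (w.1 : ℕ) = 0 ∧ (v.2 : ℕ) = 0 ∧ (w.2 : ℕ) = 1

/-! Put q = 2 - 2/p and let λ be the p-spectral radius of a graph of order m. Always λ ≤ m^q, and λ
≤ (1 - 1/r) m^q if there is no K_{r+1}; testing the constant vector shows that T_r(n) misses the
latter bound by O(r²/n²) relative to n^q. The proof passes to a subgraph H of order at least √n that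
contains K_{r+1} and in which every degree exceeds (1 - 1/r - 1/r^6)|H|, and then works
combinatorially in H.

Finding H: a nonnegative maximizer x satisfies λ x_k^(p-1) = ∑ x_j over the neighbours j of k. If
some vertex has too small a degree, this equation and the power mean inequality there force the
smallest entry to obey x_k^p ≤ (1 - η)/m, well below average (`rpow_min_entry_le`). Deleting k costs
the form only 2λ x_k^p, so λ/m^(q-κ) does not decrease, for a small κ > 0
(`exists_vertex_deletion`). Under iteration λ/m^q gains a factor (n/m)^κ; being at most 1, it stops
the process while m ≥ √n. One deletion already gains more than the O(r²/n²) deficit, so the crude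
clique-free bound yields K_{r+1} in H. Without any deletion H = G, and the exact p-spectral Turán
theorem is needed: weighted Erdős degree majorization reduces it to multipartite graphs, and joint
convexity of a (z/a)^p balances their parts.

Using H: averaging over the pairs of a K_{r+1} gives an edge uv with a large common neighbourhood.
There r - 1 parts are built by the Erdős–Stone pigeonhole argument, and one more part is found in
the whole graph. Putting u and v into this last part supplies the extra edge. -/

/-! ### The quadratic form, homogeneity and stationarity -/

/-- The sum of the weights of the neighbours of a vertex. -/
noncomputable def nbrSum {V : Type*} [Fintype V] (G : SimpleGraph V) (x : V → ℝ) (i : V) : ℝ :=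
  open Classical in ∑ j, if G.Adj i j then x j else 0

theorem graphForm_eq_sum_nbrSum {V : Type*} [Fintype V] (G : SimpleGraph V) (x : V → ℝ) :
    graphForm G x = ∑ i, x i * nbrSum G x i := by
  classical
  have h1 : ∑ i, x i * nbrSum G x i =
      ∑ a ∈ (Finset.univ : Finset (V × V)).filter (fun a => G.Adj a.1 a.2), x a.1 * x a.2 := by
    rw [Finset.sum_filter, Fintype.sum_prod_type]
    refine Finset.sum_congr rfl fun i _ => ?_
    rw [nbrSum, Finset.mul_sum]
    refine Finset.sum_congr rfl fun j _ => ?_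
    split_ifs <;> simp_all
  have h2 := Finset.sum_fiberwise_of_maps_to (s := (Finset.univ : Finset (V × V)).filter
    (fun a => G.Adj a.1 a.2)) (t := G.edgeFinset) (g := fun a => s(a.1, a.2))
    (fun a ha => by simpa using ha) (fun a => x a.1 * x a.2)
  rw [h1, ← h2, graphForm, Finset.mul_sum]
  refine Finset.sum_congr (by ext; simp) fun e he => ?_
  induction e using Sym2.ind with
  | _ a b =>
    have hab : G.Adj a b := by simpa using he
    have h3 : ((Finset.univ : Finset (V × V)).filter (fun a => G.Adj a.1 a.2)).filter
        (fun c => s(c.1, c.2) = s(a, b)) = {(a, b), (b, a)} := by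
      ext ⟨c, d⟩
      simp only [Finset.mem_filter, Finset.mem_univ, true_and, Finset.mem_insert,
        Finset.mem_singleton, Prod.mk.injEq, Sym2.eq_iff]
      constructor
      · exact fun h => h.2
      · rintro (⟨rfl, rfl⟩ | ⟨rfl, rfl⟩)
        · exact ⟨hab, Or.inl ⟨rfl, rfl⟩⟩
        · exact ⟨hab.symm, Or.inr ⟨rfl, rfl⟩⟩
    rw [h3, Finset.sum_pair (by simp [hab.ne])]
    simp only [Sym2.lift_mk]
    ring

theorem nbrSum_nonneg {V : Type*} [Fintype V] (G : SimpleGraph V) {x : V → ℝ} (hx : ∀ i, 0 ≤ x i)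
    (i : V) : 0 ≤ nbrSum G x i :=
  Finset.sum_nonneg fun j _ => by split_ifs <;> simp [hx]

theorem nbrSum_add_smul {V : Type*} [Fintype V] (G : SimpleGraph V) (x y : V → ℝ) (t : ℝ) (i : V) :
    nbrSum G (fun j => x j + t * y j) i = nbrSum G x i + t * nbrSum G y i := by
  classical
  simp only [nbrSum]
  rw [Finset.mul_sum, ← Finset.sum_add_distrib]
  refine Finset.sum_congr rfl fun j _ => ?_
  split_ifs <;> simp

theorem sum_mul_nbrSum_comm {V : Type*} [Fintype V] (G : SimpleGraph V) (x y : V → ℝ) :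
    ∑ i, x i * nbrSum G y i = ∑ i, y i * nbrSum G x i := by
  classical
  simp only [nbrSum, Finset.mul_sum]
  rw [Finset.sum_comm]
  refine Finset.sum_congr rfl fun i _ => Finset.sum_congr rfl fun j _ => ?_
  by_cases h : G.Adj i j
  · simp [h, h.symm, mul_comm]
  · have h' : ¬ G.Adj j i := fun h' => h h'.symm
    simp [h, h']

/-- Changing the weight of one vertex changes the quadratic form linearly. -/
theorem graphForm_add_single {V : Type*} [Fintype V] [DecidableEq V] (G : SimpleGraph V)
    (x : V → ℝ) (k : V) (t : ℝ) :
    graphForm G (fun j => x j + t * (Pi.single k (1 : ℝ) : V → ℝ) j) =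
      graphForm G x + 2 * t * nbrSum G x k := by
  have h1 : ∀ y : V → ℝ, ∑ i, (Pi.single k (1 : ℝ) : V → ℝ) i * nbrSum G y i = nbrSum G y k := by
    intro y
    rw [Finset.sum_eq_single k]
    · simp
    · intro b _ hb
      simp [Pi.single_eq_of_ne hb]
    · simp
  have h2 : nbrSum G (Pi.single k (1 : ℝ)) k = 0 := by
    refine Finset.sum_eq_zero fun j _ => ?_
    split_ifs with h
    · exact Pi.single_eq_of_ne h.ne' _
    · rfl
  have h3 := sum_mul_nbrSum_comm G x (Pi.single k (1 : ℝ))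
  rw [h1] at h3
  rw [graphForm_eq_sum_nbrSum, graphForm_eq_sum_nbrSum]
  simp only [nbrSum_add_smul]
  have h4 : ∀ i, (x i + t * (Pi.single k (1 : ℝ) : V → ℝ) i) *
      (nbrSum G x i + t * nbrSum G (Pi.single k 1) i) = x i * nbrSum G x i +
      (t * (x i * nbrSum G (Pi.single k 1) i) +
      (t * ((Pi.single k (1 : ℝ) : V → ℝ) i * nbrSum G x i) +
      t ^ 2 * ((Pi.single k (1 : ℝ) : V → ℝ) i * nbrSum G (Pi.single k 1) i))) := fun i => by ring
  simp only [h4, Finset.sum_add_distrib, ← Finset.mul_sum, h1, h2, h3]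
  ring

theorem graphForm_smul {V : Type*} [Fintype V] (G : SimpleGraph V) (x : V → ℝ) (a : ℝ) :
    graphForm G (fun i => a * x i) = a ^ 2 * graphForm G x := by
  have h : ∀ i, nbrSum G (fun i => a * x i) i = a * nbrSum G x i := fun i => by
    have := nbrSum_add_smul G (fun _ => 0) x a i
    simpa [nbrSum] using this
  rw [graphForm_eq_sum_nbrSum, graphForm_eq_sum_nbrSum, Finset.mul_sum]
  refine Finset.sum_congr rfl fun i _ => ?_
  rw [h]
  ring

/-- By homogeneity of degree 2, after scaling to the unit sphere. This allows test vectors of any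
p-norm. -/
theorem graphForm_le_pSpectralRadius_mul {V : Type*} [Fintype V] {p : ℝ} (hp : 1 ≤ p)
    (G : SimpleGraph V) (y : V → ℝ) :
    graphForm G y ≤ pSpectralRadius p G * (∑ i, |y i| ^ p) ^ (2 / p) := by
  have hp0 : 0 < p := by linarith
  have hnn : ∀ i ∈ Finset.univ, 0 ≤ |y i| ^ p := fun i _ => Real.rpow_nonneg (abs_nonneg _) _
  rcases (Finset.sum_nonneg hnn).eq_or_lt with h0 | hpos
  · have hy : ∀ i, y i = 0 := by
      intro i
      have := (Finset.sum_eq_zero_iff_of_nonneg hnn).1 h0.symm i (Finset.mem_univ i)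
      rw [Real.rpow_eq_zero (abs_nonneg _) hp0.ne'] at this
      exact abs_eq_zero.1 this
    rw [← h0, Real.zero_rpow (by positivity), graphForm_eq_sum_nbrSum]
    simp [hy]
  · obtain ⟨v⟩ : Nonempty V := by
      by_contra h
      rw [not_nonempty_iff] at h
      simp at hpos
    have : Nonempty V := ⟨v⟩
    set S := ∑ i, |y i| ^ p with hS
    set a := S ^ (-(1 / p)) with ha
    have ha0 : 0 < a := Real.rpow_pos_of_pos hpos _
    have hap : a ^ p = S⁻¹ := by
      rw [ha, ← Real.rpow_mul hpos.le, ← Real.rpow_neg_one]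
      congr 1
      field_simp
    have ha2 : a ^ 2 * S ^ (2 / p) = 1 := by
      rw [ha, ← Real.rpow_natCast, ← Real.rpow_mul hpos.le, ← Real.rpow_add hpos]
      convert Real.rpow_zero S using 2
      push_cast
      ring
    have hmem : graphForm G (fun i => a * y i) ∈ pSphereValues p G := by
      refine ⟨_, ?_, rfl⟩
      have : ∀ i, |a * y i| ^ p = S⁻¹ * |y i| ^ p := fun i => by
        rw [abs_mul, abs_of_pos ha0, Real.mul_rpow ha0.le (abs_nonneg _), hap]
      simp only [this, ← Finset.mul_sum]
      exact inv_mul_cancel₀ hpos.ne'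
    have hle := (isGreatest_pSpectralRadius hp G).2 hmem
    rw [graphForm_smul] at hle
    have h2 : 0 ≤ S ^ (2 / p) := Real.rpow_nonneg hpos.le _
    calc graphForm G y = (a ^ 2 * graphForm G y) * S ^ (2 / p) := by
          linear_combination (-graphForm G y) * ha2
      _ ≤ _ := mul_le_mul_of_nonneg_right hle h2

/-- Replacing entries by absolute values keeps the norm and cannot decrease the form. -/
theorem exists_nonneg_maximizer {V : Type*} [Fintype V] [Nonempty V] {p : ℝ} (hp : 1 ≤ p)
    (G : SimpleGraph V) : ∃ x : V → ℝ, (∀ i, 0 ≤ x i) ∧ ∑ i, x i ^ p = 1 ∧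
      graphForm G x = pSpectralRadius p G := by
  classical
  obtain ⟨⟨x, hx, hxG⟩, hmax⟩ := isGreatest_pSpectralRadius hp G
  refine ⟨fun i => |x i|, fun i => abs_nonneg _, hx, le_antisymm ?_ ?_⟩
  · exact hmax ⟨fun i => |x i|, by simpa using hx, rfl⟩
  · rw [← hxG, graphForm_eq_sum_nbrSum, graphForm_eq_sum_nbrSum]
    refine Finset.sum_le_sum fun i _ => ?_
    refine (le_abs_self _).trans ?_
    rw [abs_mul]
    refine mul_le_mul_of_nonneg_left ?_ (abs_nonneg _)
    refine (Finset.abs_sum_le_sum_abs _ _).trans (Finset.sum_le_sum fun j _ => ?_)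
    split_ifs <;> simp

theorem pSpectralRadius_nonneg {V : Type*} [Fintype V] {p : ℝ} (hp : 1 ≤ p)
    (G : SimpleGraph V) : 0 ≤ pSpectralRadius p G := by
  rcases isEmpty_or_nonempty V with h | h
  · have : pSphereValues p G = ∅ := by
      ext y
      simp [pSphereValues]
    rw [pSpectralRadius, this, Real.sSup_empty]
  · obtain ⟨x, hx, -, hG⟩ := exists_nonneg_maximizer hp G
    rw [← hG, graphForm_eq_sum_nbrSum]
    exact Finset.sum_nonneg fun i _ => mul_nonneg (hx i) (nbrSum_nonneg G hx i)

/-- The stationarity condition at a nonnegative maximizer. -/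
theorem nbrSum_eq_of_maximizer {V : Type*} [Fintype V] {p : ℝ} (hp : 1 < p)
    (G : SimpleGraph V) {x : V → ℝ} (hx : ∀ i, 0 ≤ x i) (hx1 : ∑ i, x i ^ p = 1)
    (hG : graphForm G x = pSpectralRadius p G) (k : V) :
    nbrSum G x k = pSpectralRadius p G * x k ^ (p - 1) := by
  classical
  have hp0 : 0 < p := by linarith
  set l := pSpectralRadius p G with hl
  -- By homogeneity f ≥ 0, with f 0 = 0, so f'(0) = 0 takes the place of Lagrange multipliers. Since
  -- p > 1, |·|^p is differentiable even at 0.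
  let f : ℝ → ℝ := fun t => l * (1 - x k ^ p + |x k + t| ^ p) ^ (2 / p) -
    (l + 2 * t * nbrSum G x k)
  have hf0 : f 0 = 0 := by
    simp [f, abs_of_nonneg (hx k)]
  have hfnn : ∀ t, 0 ≤ f t := by
    intro t
    have h := graphForm_le_pSpectralRadius_mul hp.le G
      (fun j => x j + t * (Pi.single k (1 : ℝ) : V → ℝ) j)
    rw [graphForm_add_single, hG] at h
    have hs : ∑ i, |x i + t * (Pi.single k (1 : ℝ) : V → ℝ) i| ^ p =
        1 - x k ^ p + |x k + t| ^ p := by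
      have hx1' := hx1
      rw [← Finset.add_sum_erase _ _ (Finset.mem_univ k)] at hx1'
      rw [← Finset.add_sum_erase _ _ (Finset.mem_univ k)]
      have : ∑ i ∈ Finset.univ.erase k, |x i + t * (Pi.single k (1 : ℝ) : V → ℝ) i| ^ p =
          ∑ i ∈ Finset.univ.erase k, x i ^ p := by
        refine Finset.sum_congr rfl fun i hi => ?_
        rw [Pi.single_eq_of_ne (Finset.ne_of_mem_erase hi), mul_zero, add_zero,
          abs_of_nonneg (hx i)]
      rw [this, Pi.single_eq_same, mul_one]
      linarith
    rw [hs] at h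
    simp only [f]
    linarith
  have hmin : IsLocalMin f 0 := Filter.Eventually.of_forall fun t => by rw [hf0]; exact hfnn t
  have h1 : HasDerivAt (fun t : ℝ => |x k + t| ^ p) (p * |x k| ^ (p - 2) * x k) 0 := by
    have h := hasDerivAt_abs_rpow (x k + 0) hp
    have h' := h.comp_const_add (x k) 0
    simpa using h'
  have h2 : HasDerivAt f (l * ((p * |x k| ^ (p - 2) * x k) * (2 / p) *
      (1 - x k ^ p + |x k + 0| ^ p) ^ (2 / p - 1)) - 2 * nbrSum G x k) 0 := by
    have h3 := (h1.const_add (1 - x k ^ p)).rpow_const (p := 2 / p)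
      (Or.inl (by simp [abs_of_nonneg (hx k)]))
    have h4 : HasDerivAt (fun t : ℝ => l + 2 * t * nbrSum G x k) (2 * nbrSum G x k) 0 := by
      have := (((hasDerivAt_id (0 : ℝ)).const_mul 2).mul_const (nbrSum G x k)).const_add l
      simpa using this
    exact (h3.const_mul l).sub h4
  have h5 := hmin.hasDerivAt_eq_zero h2
  have h6 : |x k| ^ (p - 2) * x k = x k ^ (p - 1) := by
    rw [abs_of_nonneg (hx k)]
    rcases (hx k).eq_or_lt with h0 | hpos
    · rw [← h0, mul_zero, Real.zero_rpow (by linarith)]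
    · rw [← Real.rpow_add_one hpos.ne']
      congr 1
      ring
  rw [add_zero, abs_of_nonneg (hx k), sub_add_cancel, Real.one_rpow, mul_one] at h5
  rw [abs_of_nonneg (hx k)] at h6
  have h7 : p * x k ^ (p - 2) * x k * (2 / p) = 2 * x k ^ (p - 1) := by
    rw [← h6]
    field_simp
  rw [h7] at h5
  linarith

/-! ### Power means and graphs without large cliques -/

theorem sum_rpow_le_card_rpow {ι : Type*} (s : Finset ι) {p : ℝ} (hp : 1 ≤ p) {x : ι → ℝ}
    (hx : ∀ i ∈ s, 0 ≤ x i) (hx1 : ∑ i ∈ s, x i ^ p ≤ 1) :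
    (∑ i ∈ s, x i) ^ 2 ≤ (s.card : ℝ) ^ (2 - 2 / p) := by
  have hp0 : 0 < p := by linarith
  have h := Real.rpow_sum_le_const_mul_sum_rpow_of_nonneg s hp hx
  have h0 : 0 ≤ ∑ i ∈ s, x i := Finset.sum_nonneg hx
  have hc : (0 : ℝ) ≤ (s.card : ℝ) ^ (p - 1) := Real.rpow_nonneg (Nat.cast_nonneg _) _
  have h1 : (∑ i ∈ s, x i) ^ p ≤ (s.card : ℝ) ^ (p - 1) := by nlinarith
  have h2 := Real.rpow_le_rpow (Real.rpow_nonneg h0 _) h1 (show 0 ≤ 2 / p by positivity)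
  rw [← Real.rpow_mul h0, ← Real.rpow_mul (Nat.cast_nonneg _)] at h2
  have e1 : p * (2 / p) = (2 : ℕ) := by push_cast; field_simp
  have e2 : (p - 1) * (2 / p) = 2 - 2 / p := by field_simp
  rwa [e1, e2, Real.rpow_natCast] at h2

theorem graphForm_le_sum_sq {V : Type*} [Fintype V] (G : SimpleGraph V) {x : V → ℝ}
    (hx : ∀ i, 0 ≤ x i) : graphForm G x ≤ (∑ i, x i) ^ 2 := by
  classical
  rw [graphForm_eq_sum_nbrSum, sq, Finset.sum_mul]
  refine Finset.sum_le_sum fun i _ => mul_le_mul_of_nonneg_left ?_ (hx i)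
  refine Finset.sum_le_sum fun j _ => ?_
  split_ifs <;> simp [hx]

theorem pSpectralRadius_le_card_rpow {V : Type*} [Fintype V] {p : ℝ} (hp : 1 ≤ p)
    (G : SimpleGraph V) : pSpectralRadius p G ≤ (Fintype.card V : ℝ) ^ (2 - 2 / p) := by
  rcases isEmpty_or_nonempty V with h | h
  · have : pSphereValues p G = ∅ := by
      ext y
      simp [pSphereValues]
    rw [pSpectralRadius, this, Real.sSup_empty]
    exact Real.rpow_nonneg (Nat.cast_nonneg _) _
  · obtain ⟨x, hx, hx1, hG⟩ := exists_nonneg_maximizer hp G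
    rw [← hG]
    exact (graphForm_le_sum_sq G hx).trans
      (sum_rpow_le_card_rpow _ hp (fun i _ => hx i) hx1.le)

/-- Weighted form of Erdős' degree majorization: the weighted degrees of a graph without
`(r + 1)`-cliques are dominated by those of a complete `r`-partite graph. -/
theorem exists_coloring_majorizing {V : Type*} [Fintype V] [DecidableEq V] (G : SimpleGraph V)
    [DecidableRel G.Adj] {x : V → ℝ} (hx : ∀ i, 0 ≤ x i) (r : ℕ) : ∀ S : Finset V,
    G.CliqueFreeOn S (r + 1) → ∃ χ : V → ℕ, (∀ u ∈ S, χ u < r) ∧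
      ∀ u ∈ S, ∑ w ∈ S with G.Adj u w, x w ≤ ∑ w ∈ S with χ u ≠ χ w, x w := by
  induction r with
  | zero =>
    intro S hS
    have hSe : ∀ u ∈ S, False := fun u hu =>
      hS (t := {u}) (by simpa using hu) (by simp [SimpleGraph.isNClique_iff])
    exact ⟨fun _ => 0, fun u hu => (hSe u hu).elim, fun u hu => (hSe u hu).elim⟩
  | succ r ih =>
    intro S hS
    rcases S.eq_empty_or_nonempty with rfl | hne
    · exact ⟨fun _ => 0, by simp, by simp⟩
    -- The neighbourhood T of a vertex v of maximum weighted degree is coloured by induction, and S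
    -- \ T gets the single colour r. A vertex of T is credited with all of S \ T; a vertex outside T
    -- is credited with all of T, which is the weighted degree of v.
    obtain ⟨v, hv, hmax⟩ := S.exists_max_image (fun u => ∑ w ∈ S with G.Adj u w, x w) hne
    set T := S.filter (fun w => G.Adj v w) with hT
    have hTS : T ⊆ S := Finset.filter_subset _ _
    have hTfree : G.CliqueFreeOn T (r + 1) := by
      intro t ht hcl
      refine hS (t := insert v t) ?_ (hcl.insert fun b hb => ?_)
      · rw [Finset.coe_insert, Set.insert_subset_iff]
        exact ⟨hv, ht.trans (Finset.coe_subset.2 hTS)⟩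
      · exact (Finset.mem_filter.1 (ht hb)).2
    obtain ⟨χ, hχ, hdeg⟩ := ih T hTfree
    refine ⟨fun u => if u ∈ T then χ u else r, fun u _ => ?_, fun u hu => ?_⟩
    · by_cases h : u ∈ T
      · simpa [h] using (hχ u h).trans (Nat.lt_succ_self r)
      · simp [h]
    · by_cases h : u ∈ T
      · have e1 : ∑ w ∈ S with (if u ∈ T then χ u else r) ≠ (if w ∈ T then χ w else r), x w =
            ∑ w ∈ T with χ u ≠ χ w, x w + ∑ w ∈ S \ T, x w := by
          rw [← Finset.sum_union]
          · refine Finset.sum_congr ?_ fun _ _ => rfl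
            ext w
            simp only [Finset.mem_filter, Finset.mem_union, Finset.mem_sdiff, h, if_true]
            by_cases hw : w ∈ T
            · simp [hw, hTS hw]
            · simp [hw, (hχ u h).ne]
          · rw [Finset.disjoint_left]
            intro w hw hw'
            exact (Finset.mem_sdiff.1 hw').2 (Finset.mem_filter.1 hw).1
        have e2 : ∑ w ∈ S with G.Adj u w, x w ≤
            ∑ w ∈ T with G.Adj u w, x w + ∑ w ∈ S \ T, x w := by
          rw [← Finset.sum_union]
          · refine Finset.sum_le_sum_of_subset_of_nonneg ?_ fun i _ _ => hx i
            intro w hw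
            rw [Finset.mem_filter] at hw
            by_cases hwT : w ∈ T
            · exact Finset.mem_union_left _ (Finset.mem_filter.2 ⟨hwT, hw.2⟩)
            · exact Finset.mem_union_right _ (Finset.mem_sdiff.2 ⟨hw.1, hwT⟩)
          · rw [Finset.disjoint_left]
            intro w hw hw'
            exact (Finset.mem_sdiff.1 hw').2 (Finset.mem_filter.1 hw).1
        rw [e1]
        linarith [hdeg u h]
      · have e1 : ∑ w ∈ S with (if u ∈ T then χ u else r) ≠ (if w ∈ T then χ w else r), x w =
            ∑ w ∈ T, x w := by
          refine Finset.sum_congr ?_ fun _ _ => rfl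
          ext w
          simp only [Finset.mem_filter, h, if_false]
          by_cases hw : w ∈ T
          · simp [hw, hTS hw, (hχ w hw).ne']
          · simp [hw]
        rw [e1]
        exact hmax u hu

/-- Multiplying the majorization by x u and summing over u bounds the form by that of the complete
multipartite graph of the colour classes. -/
theorem exists_fin_coloring_majorizing {V : Type*} [Fintype V] (G : SimpleGraph V) {x : V → ℝ}
    (hx : ∀ i, 0 ≤ x i) {r : ℕ} (hG : G.CliqueFree (r + 1)) :
    ∃ χ : V → Fin r, graphForm G x ≤
      (∑ v, x v) ^ 2 - ∑ i, (∑ v, if χ v = i then x v else 0) ^ 2 := by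
  classical
  obtain ⟨χ, hχ, hdeg⟩ := exists_coloring_majorizing G hx r Finset.univ
    (by simpa using hG.cliqueFreeOn (s := Set.univ))
  refine ⟨fun v => ⟨χ v, hχ v (Finset.mem_univ v)⟩, ?_⟩
  have h1 : ∑ i : Fin r, (∑ v, if (⟨χ v, hχ v (Finset.mem_univ v)⟩ : Fin r) = i then x v else 0) ^ 2
      = ∑ u, x u * ∑ w, if χ u = χ w then x w else 0 := by
    simp only [sq, Finset.sum_mul, Finset.mul_sum]
    rw [Finset.sum_comm]
    refine Finset.sum_congr rfl fun u _ => ?_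
    rw [Finset.sum_comm]
    refine Finset.sum_congr rfl fun w _ => ?_
    rw [Finset.sum_eq_single (⟨χ u, hχ u (Finset.mem_univ u)⟩ : Fin r)]
    · simp [eq_comm, mul_comm]
    · intro b _ hb
      simp [hb.symm]
    · simp
  rw [h1, graphForm_eq_sum_nbrSum, sq, Finset.sum_mul, ← Finset.sum_sub_distrib]
  refine Finset.sum_le_sum fun u _ => ?_
  rw [← mul_sub]
  refine mul_le_mul_of_nonneg_left ?_ (hx u)
  have h2 := hdeg u (Finset.mem_univ u)
  rw [Finset.sum_filter, Finset.sum_filter] at h2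
  have h3 : ∑ w, (if χ u ≠ χ w then x w else 0) =
      ∑ w, x w - ∑ w, (if χ u = χ w then x w else 0) := by
    rw [← Finset.sum_sub_distrib]
    refine Finset.sum_congr rfl fun w _ => ?_
    by_cases h : χ u = χ w <;> simp [h]
  rw [← h3]
  refine le_trans (le_of_eq ?_) h2
  exact Finset.sum_congr rfl fun w _ => by congr

theorem sum_fiber_sums {V : Type*} [Fintype V] {r : ℕ} (χ : V → Fin r) (x : V → ℝ) :
    ∑ i, (∑ v, if χ v = i then x v else 0) = ∑ v, x v := by
  rw [Finset.sum_comm]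
  exact Finset.sum_congr rfl fun v _ => by simp

/-- Cauchy–Schwarz on the r class sums, then the power mean bound for ∑ x. This is a Wilf-type
bound, sharp only up to divisibility of the order by r. -/
theorem pSpectralRadius_le_of_cliqueFree {V : Type*} [Fintype V] {p : ℝ} (hp : 1 ≤ p)
    (G : SimpleGraph V) {r : ℕ} (hr : 0 < r) (hG : G.CliqueFree (r + 1)) :
    pSpectralRadius p G ≤ (1 - 1 / (r : ℝ)) * (Fintype.card V : ℝ) ^ (2 - 2 / p) := by
  classical
  have hr1 : (1 : ℝ) ≤ r := by exact_mod_cast hr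
  have hA : 0 ≤ 1 - 1 / (r : ℝ) := by
    rw [sub_nonneg, div_le_one (by linarith)]
    exact hr1
  rcases isEmpty_or_nonempty V with h | h
  · have : pSphereValues p G = ∅ := by
      ext y
      simp [pSphereValues]
    rw [pSpectralRadius, this, Real.sSup_empty]
    exact mul_nonneg hA (Real.rpow_nonneg (Nat.cast_nonneg _) _)
  · obtain ⟨x, hx, hx1, hxG⟩ := exists_nonneg_maximizer hp G
    obtain ⟨χ, hχ⟩ := exists_fin_coloring_majorizing G hx hG
    have h1 := sum_rpow_le_card_rpow Finset.univ hp (fun i _ => hx i) hx1.le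
    have h2 := sq_sum_le_card_mul_sum_sq (s := (Finset.univ : Finset (Fin r)))
      (f := fun i => ∑ v, if χ v = i then x v else 0)
    rw [sum_fiber_sums, Finset.card_univ, Fintype.card_fin] at h2
    have h3 : (∑ v, x v) ^ 2 / r ≤ ∑ i, (∑ v, if χ v = i then x v else 0) ^ 2 := by
      rw [div_le_iff₀ (by linarith)]
      linarith
    rw [← hxG]
    calc graphForm G x ≤ (∑ v, x v) ^ 2 - (∑ v, x v) ^ 2 / r := by linarith
      _ = (1 - 1 / (r : ℝ)) * (∑ v, x v) ^ 2 := by ring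
      _ ≤ _ := mul_le_mul_of_nonneg_left h1 hA

/-! ### Balancing the parts: the p-spectral Turán theorem -/

/-- The perspective `a * (z / a) ^ p` of the `p`-th power is jointly convex. -/
theorem perspective_rpow_convex {p : ℝ} (hp : 1 ≤ p) {a b z w α β : ℝ} (ha : 0 ≤ a) (hb : 0 ≤ b)
    (hz : 0 ≤ z) (hw : 0 ≤ w) (haz : a = 0 → z = 0) (hbw : b = 0 → w = 0) (hα : 0 ≤ α)
    (hβ : 0 ≤ β) :
    (α * a + β * b) * ((α * z + β * w) / (α * a + β * b)) ^ p ≤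
      α * (a * (z / a) ^ p) + β * (b * (w / b) ^ p) := by
  set s := α * a + β * b with hs
  have hαa : 0 ≤ α * a := mul_nonneg hα ha
  have hβb : 0 ≤ β * b := mul_nonneg hβ hb
  have hRHS : 0 ≤ α * (a * (z / a) ^ p) + β * (b * (w / b) ^ p) :=
    add_nonneg (mul_nonneg hα (mul_nonneg ha (Real.rpow_nonneg (div_nonneg hz ha) _)))
      (mul_nonneg hβ (mul_nonneg hb (Real.rpow_nonneg (div_nonneg hw hb) _)))
  rcases (add_nonneg hαa hβb).eq_or_lt with h0 | hpos
  · rw [hs, ← h0, zero_mul]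
    exact hRHS
  rw [← hs] at hpos
  have hza : a * (z / a) = z := by
    rcases eq_or_ne a 0 with h | h
    · rw [haz h, h]; simp
    · field_simp
  have hwb : b * (w / b) = w := by
    rcases eq_or_ne b 0 with h | h
    · rw [hbw h, h]; simp
    · field_simp
  have hconv := (convexOn_rpow hp).2 (show z / a ∈ Set.Ici 0 from div_nonneg hz ha)
    (show w / b ∈ Set.Ici 0 from div_nonneg hw hb) (div_nonneg hαa hpos.le)
    (div_nonneg hβb hpos.le) (by rw [← add_div, ← hs, div_self hpos.ne'])
  simp only [smul_eq_mul] at hconv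
  have e : α * a / s * (z / a) + β * b / s * (w / b) = (α * z + β * w) / s := by
    calc _ = (α * (a * (z / a)) + β * (b * (w / b))) / s := by ring
      _ = _ := by rw [hza, hwb]
  rw [e] at hconv
  have := mul_le_mul_of_nonneg_left hconv hpos.le
  refine this.trans (le_of_eq ?_)
  field_simp

/-- Moving the part sizes of a complete multipartite graph to a balanced vector `b`, the part
weights can be adjusted without increasing the `p`-norm or decreasing the quadratic form. -/
theorem exists_balanced_weights {p : ℝ} (hp : 1 ≤ p) {r : ℕ} (b : Fin r → ℕ)
    (hb : ∀ i j, b i ≤ b j + 1) (k : ℕ) : ∀ (a : Fin r → ℕ) (z : Fin r → ℝ),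
    ∑ i, (a i - b i) = k → ∑ i, a i = ∑ i, b i → (∀ i, 0 ≤ z i) → (∀ i, a i = 0 → z i = 0) →
    ∃ z' : Fin r → ℝ, (∀ i, 0 ≤ z' i) ∧ (∀ i, b i = 0 → z' i = 0) ∧ ∑ i, z' i = ∑ i, z i ∧
      ∑ i, z' i ^ 2 ≤ ∑ i, z i ^ 2 ∧
      ∑ i, (b i : ℝ) * (z' i / b i) ^ p ≤ ∑ i, (a i : ℝ) * (z i / a i) ^ p := by
  induction k with
  | zero =>
    intro a z hk hab hz haz
    have hle : ∀ i, a i ≤ b i := fun i => by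
      have := (Finset.sum_eq_zero_iff.1 hk) i (Finset.mem_univ i)
      omega
    have heq : a = b := by
      funext i
      exact (Finset.sum_eq_sum_iff_of_le fun i _ => hle i).1 hab i (Finset.mem_univ i)
    subst heq
    exact ⟨z, hz, haz, rfl, le_rfl, le_rfl⟩
  | succ k ih =>
    intro a z hk hab hz haz
    obtain ⟨i, hi⟩ : ∃ i, b i < a i := by
      by_contra! h
      rw [Finset.sum_eq_zero fun i _ => by have := h i; omega] at hk
      omega
    obtain ⟨j, hj⟩ : ∃ j, a j < b j := by
      by_contra! h
      exact (Finset.sum_lt_sum (fun i _ => h i) ⟨i, Finset.mem_univ i, hi⟩).ne hab.symm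
    have hij : i ≠ j := by rintro rfl; omega
    have hlt : a j < a i := by have := hb j i; omega
    set a' : Fin r → ℕ := Function.update (Function.update a i (a i - 1)) j (a j + 1) with ha'
    -- With this θ, mixing a i and a j in proportions 1 - θ and θ moves exactly one vertex from part
    -- i to part j. Mixing z i and z j likewise keeps the sum, does not increase the sum of squares,
    -- and by convexity does not increase the p-cost.
    set θ : ℝ := 1 / ((a i : ℝ) - a j) with hθ
    have hd : (1 : ℝ) ≤ (a i : ℝ) - a j := by
      have : (a j : ℝ) + 1 ≤ a i := by exact_mod_cast hlt
      linarith
    have hθ0 : 0 ≤ θ := by positivity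
    have hθ1 : θ ≤ 1 := by rw [hθ, div_le_one (by linarith)]; exact hd
    have hθd : θ * ((a i : ℝ) - a j) = 1 := by rw [hθ]; field_simp
    set zi := (1 - θ) * z i + θ * z j with hzi
    set zj := θ * z i + (1 - θ) * z j with hzj
    set z' : Fin r → ℝ := Function.update (Function.update z i zi) j zj with hz'
    have hzi0 : 0 ≤ zi := add_nonneg (mul_nonneg (by linarith) (hz i)) (mul_nonneg hθ0 (hz j))
    have hzj0 : 0 ≤ zj := add_nonneg (mul_nonneg hθ0 (hz i)) (mul_nonneg (by linarith) (hz j))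
    have a'i : a' i = a i - 1 := by simp [ha', hij]
    have a'j : a' j = a j + 1 := by simp [ha']
    have a'o : ∀ l, l ≠ i → l ≠ j → a' l = a l := fun l h1 h2 => by simp [ha', h1, h2]
    have z'i : z' i = zi := by simp [hz', hij]
    have z'j : z' j = zj := by simp [hz']
    have z'o : ∀ l, l ≠ i → l ≠ j → z' l = z l := fun l h1 h2 => by simp [hz', h1, h2]
    have split : ∀ {M : Type} [AddCommMonoid M] (f : Fin r → M),
        ∑ l, f l = f i + (f j + ∑ l ∈ (Finset.univ.erase i).erase j, f l) := by
      intro M _ f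
      rw [Finset.add_sum_erase _ _ (Finset.mem_erase.2 ⟨hij.symm, Finset.mem_univ j⟩),
        Finset.add_sum_erase _ _ (Finset.mem_univ i)]
    have rest : ∀ {M : Type} [AddCommMonoid M] (f g : Fin r → M),
        (∀ l, l ≠ i → l ≠ j → f l = g l) → ∑ l ∈ (Finset.univ.erase i).erase j, f l =
        ∑ l ∈ (Finset.univ.erase i).erase j, g l := by
      intro M _ f g h
      refine Finset.sum_congr rfl fun l hl => ?_
      simp only [Finset.mem_erase, Finset.mem_univ, and_true] at hl
      exact h l hl.2 hl.1
    have hk' : ∑ l, (a' l - b l) = k := by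
      have h1 := rest (fun l => a' l - b l) (fun l => a l - b l)
        (fun l h1 h2 => by rw [a'o l h1 h2])
      rw [split] at hk ⊢
      rw [h1, a'i, a'j]
      omega
    have hab' : ∑ l, a' l = ∑ l, b l := by
      have h1 := rest a' a a'o
      rw [split] at hab
      rw [split, ← hab, h1, a'i, a'j]
      omega
    have hz'0 : ∀ l, 0 ≤ z' l := by
      intro l
      by_cases h1 : l = i
      · rw [h1, z'i]; exact hzi0
      by_cases h2 : l = j
      · rw [h2, z'j]; exact hzj0
      rw [z'o l h1 h2]; exact hz l
    -- If the move empties part i, then a i = 1 and a j = 0, so θ = 1 and the new weight is z j = 0.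
    have ha'z' : ∀ l, a' l = 0 → z' l = 0 := by
      intro l hl
      by_cases h1 : l = i
      · rw [h1, a'i] at hl
        have h3 : a j = 0 := by omega
        have h4 : a i = 1 := by omega
        rw [h1, z'i, hzi, haz j h3]
        rw [h3, h4] at hθd
        norm_num at hθd
        rw [hθd]
        ring
      by_cases h2 : l = j
      · rw [h2, a'j] at hl; omega
      rw [z'o l h1 h2]
      rw [a'o l h1 h2] at hl
      exact haz l hl
    obtain ⟨y, hy0, hby, hysum, hysq, hyp⟩ := ih a' z' hk' hab' hz'0 ha'z'
    refine ⟨y, hy0, hby, hysum.trans ?_, hysq.trans ?_, hyp.trans ?_⟩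
    · rw [split, split z, rest z' z z'o, z'i, z'j]
      ring
    · rw [split, split (fun l => z l ^ 2), rest (fun l => z' l ^ 2) (fun l => z l ^ 2)
        (fun l h1 h2 => by rw [z'o l h1 h2]), z'i, z'j]
      have : zi ^ 2 + zj ^ 2 ≤ z i ^ 2 + z j ^ 2 := by
        have h := mul_nonneg (mul_nonneg hθ0 (sub_nonneg.2 hθ1)) (sq_nonneg (z i - z j))
        rw [hzi, hzj]
        nlinarith
      linarith
    · rw [split, split (fun l => (a l : ℝ) * (z l / a l) ^ p),
        rest (fun l => (a' l : ℝ) * (z' l / a' l) ^ p) (fun l => (a l : ℝ) * (z l / a l) ^ p)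
        (fun l h1 h2 => by rw [z'o l h1 h2, a'o l h1 h2]), z'i, z'j, a'i, a'j]
      have hz1 : (a i : ℝ) = 0 → z i = 0 := fun h => haz i (by exact_mod_cast h)
      have hz2 : (a j : ℝ) = 0 → z j = 0 := fun h => haz j (by exact_mod_cast h)
      have c1 := perspective_rpow_convex hp (Nat.cast_nonneg (a i)) (Nat.cast_nonneg (a j)) (hz i)
        (hz j) hz1 hz2 (sub_nonneg.2 hθ1) hθ0
      have c2 := perspective_rpow_convex hp (Nat.cast_nonneg (a i)) (Nat.cast_nonneg (a j)) (hz i)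
        (hz j) hz1 hz2 hθ0 (sub_nonneg.2 hθ1)
      have e1 : ((a i - 1 : ℕ) : ℝ) = (1 - θ) * a i + θ * a j := by
        rw [Nat.cast_sub (by omega)]
        push_cast
        linarith
      have e2 : ((a j + 1 : ℕ) : ℝ) = θ * a i + (1 - θ) * a j := by
        push_cast
        linarith
      rw [e1, e2]
      linarith

/-- Spreading a given total weight evenly over a class minimizes its contribution to the p-norm. -/
theorem mul_div_rpow_le_sum_rpow {ι : Type*} (s : Finset ι) {p : ℝ} (hp : 1 ≤ p) {x : ι → ℝ}
    (hx : ∀ i ∈ s, 0 ≤ x i) :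
    (s.card : ℝ) * ((∑ i ∈ s, x i) / s.card) ^ p ≤ ∑ i ∈ s, x i ^ p := by
  rcases s.eq_empty_or_nonempty with rfl | hne
  · simp
  have hc : (0 : ℝ) < s.card := by exact_mod_cast hne.card_pos
  have h := Real.rpow_sum_le_const_mul_sum_rpow_of_nonneg s hp hx
  rw [Real.div_rpow (Finset.sum_nonneg hx) hc.le, ← mul_div_assoc,
    div_le_iff₀ (Real.rpow_pos_of_pos hc _)]
  calc (s.card : ℝ) * (∑ i ∈ s, x i) ^ p
      ≤ s.card * ((s.card : ℝ) ^ (p - 1) * ∑ i ∈ s, x i ^ p) :=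
        mul_le_mul_of_nonneg_left h hc.le
    _ = ((s.card : ℝ) ^ (p - 1) * (s.card : ℝ)) * ∑ i ∈ s, x i ^ p := by ring
    _ = _ := by
        rw [← Real.rpow_add_one hc.ne', sub_add_cancel, mul_comm]

theorem card_fin_filter_mod_eq (n r : ℕ) (hr : 0 < r) (i : Fin r) :
    (Finset.univ.filter fun v : Fin n => (v : ℕ) % r = i).card =
      n / r + if (i : ℕ) < n % r then 1 else 0 := by
  have h := Nat.count_modEq_card n hr (i : ℕ)
  rw [Nat.mod_eq_of_lt i.2] at h
  rw [← h, Nat.count_eq_card_filter_range, Finset.card_filter, Finset.card_filter,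
    Finset.sum_range]
  refine Finset.sum_congr rfl fun v _ => ?_
  simp [Nat.ModEq, Nat.mod_eq_of_lt i.2]

/-- The `p`-spectral Turán theorem. -/
theorem pSpectralRadius_le_turanGraph {V : Type*} [Fintype V] {p : ℝ} (hp : 1 ≤ p)
    (G : SimpleGraph V) {r : ℕ} (hr : 0 < r) (hG : G.CliqueFree (r + 1)) :
    pSpectralRadius p G ≤ pSpectralRadius p (SimpleGraph.turanGraph (Fintype.card V) r) := by
  classical
  have hp0 : 0 < p := by linarith
  set n := Fintype.card V with hn
  rcases isEmpty_or_nonempty V with h | h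
  · have : pSphereValues p G = ∅ := by
      ext y
      simp [pSphereValues]
    rw [pSpectralRadius, this, Real.sSup_empty]
    exact pSpectralRadius_nonneg hp _
  obtain ⟨x, hx, hx1, hxG⟩ := exists_nonneg_maximizer hp G
  obtain ⟨χ, hχ⟩ := exists_fin_coloring_majorizing G hx hG
  let μ : Fin n → Fin r := fun v => ⟨v % r, Nat.mod_lt _ hr⟩
  set a : Fin r → ℕ := fun i => (Finset.univ.filter fun v => χ v = i).card with ha
  set b : Fin r → ℕ := fun i => (Finset.univ.filter fun v => μ v = i).card with hb
  set z : Fin r → ℝ := fun i => ∑ v with χ v = i, x v with hz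
  have hbal : ∀ i j, b i ≤ b j + 1 := by
    have h : ∀ i, b i = n / r + if (i : ℕ) < n % r then 1 else 0 := fun i => by
      rw [← card_fin_filter_mod_eq n r hr i, hb]
      simp [μ, Fin.ext_iff]
    intro i j
    rw [h, h]
    split_ifs <;> omega
  have hab : ∑ i, a i = ∑ i, b i := by
    have h1 := Finset.card_eq_sum_card_fiberwise (s := (Finset.univ : Finset V))
      (t := (Finset.univ : Finset (Fin r))) (f := χ) (by intro; simp)
    have h2 := Finset.card_eq_sum_card_fiberwise (s := (Finset.univ : Finset (Fin n)))
      (t := (Finset.univ : Finset (Fin r))) (f := μ) (by intro; simp)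
    rw [Finset.card_univ] at h1 h2
    rw [ha, hb, ← h1, ← h2, Fintype.card_fin]
  have haz : ∀ i, a i = 0 → z i = 0 := by
    intro i hi
    rw [ha] at hi
    simp only [Finset.card_eq_zero] at hi
    simp [hz, hi]
  obtain ⟨y, hy0, hby, hysum, hysq, hyp⟩ := exists_balanced_weights hp b hbal _ a z rfl hab
    (fun i => Finset.sum_nonneg fun v _ => hx v) haz
  -- The weight y i is spread evenly over the i-th Turán part. An empty part has y i = 0, so
  -- division by zero does no harm.
  let w : Fin n → ℝ := fun v => y (μ v) / b (μ v)
  have hw0 : ∀ v, 0 ≤ w v := fun v => div_nonneg (hy0 _) (Nat.cast_nonneg _)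
  have hfib : ∀ (g : Fin r → ℝ), ∑ v, g (μ v) = ∑ i, (b i : ℝ) * g i := by
    intro g
    rw [← Finset.sum_fiberwise (Finset.univ) μ]
    refine Finset.sum_congr rfl fun i _ => ?_
    rw [Finset.sum_congr rfl (g := fun _ => g i)
      (fun v hv => by rw [(Finset.mem_filter.1 hv).2]), Finset.sum_const, nsmul_eq_mul]
  have hbyi : ∀ i, (b i : ℝ) * (y i / b i) = y i := by
    intro i
    rcases Nat.eq_zero_or_pos (b i) with h | h
    · simp [h, hby i h]
    · have : (b i : ℝ) ≠ 0 := by exact_mod_cast h.ne'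
      field_simp
  have hwsum : ∑ v, w v = ∑ i, y i := by
    rw [hfib (fun i => y i / b i)]
    exact Finset.sum_congr rfl fun i _ => hbyi i
  have hwp : ∑ v, |w v| ^ p ≤ 1 := by
    have h1 : ∑ v, |w v| ^ p = ∑ v, (fun i => (y i / b i) ^ p) (μ v) :=
      Finset.sum_congr rfl fun v _ => by rw [abs_of_nonneg (hw0 v)]
    rw [h1, hfib (fun i => (y i / b i) ^ p), ← hx1, ← Finset.sum_fiberwise Finset.univ χ]
    exact hyp.trans (Finset.sum_le_sum fun i _ => mul_div_rpow_le_sum_rpow _ hp fun v _ => hx v)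
  have hform : graphForm (SimpleGraph.turanGraph n r) w = (∑ i, y i) ^ 2 - ∑ i, y i ^ 2 := by
    have h1 : ∀ v, nbrSum (SimpleGraph.turanGraph n r) w v = ∑ i, y i - y (μ v) := by
      intro v
      have h2 : y (μ v) = ∑ u, if μ u = μ v then w u else 0 := by
        have := hfib (fun i => if i = μ v then y i / b i else 0)
        rw [Finset.sum_eq_single (μ v)] at this
        · rw [if_pos rfl, hbyi] at this
          exact this.symm
        · intro i _ hi
          rw [if_neg hi, mul_zero]
        · simp
      rw [h2, ← hwsum, nbrSum, ← Finset.sum_sub_distrib]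
      refine Finset.sum_congr rfl fun u _ => ?_
      have h3 : (SimpleGraph.turanGraph n r).Adj v u ↔ ¬ μ u = μ v := by
        simp [SimpleGraph.turanGraph_adj, μ, Fin.ext_iff, eq_comm]
      by_cases h : μ u = μ v <;> simp [h3, h]
    rw [graphForm_eq_sum_nbrSum]
    simp only [h1, mul_sub, Finset.sum_sub_distrib, ← Finset.sum_mul, hwsum]
    have h4 := hfib (fun i => y i / b i * y i)
    have h5 : ∀ i, (b i : ℝ) * (y i / b i * y i) = y i ^ 2 := fun i => by
      rw [← mul_assoc, hbyi, sq]
    simp only [h5] at h4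
    rw [← h4]
    ring
  have hle := graphForm_le_pSpectralRadius_mul hp (SimpleGraph.turanGraph n r) w
  have hpow : (∑ v, |w v| ^ p) ^ (2 / p) ≤ 1 :=
    Real.rpow_le_one (Finset.sum_nonneg fun v _ => Real.rpow_nonneg (abs_nonneg _) _) hwp
      (by positivity)
  have hle2 := mul_le_mul_of_nonneg_left hpow
    (pSpectralRadius_nonneg hp (SimpleGraph.turanGraph n r))
  have hz2 : ∀ i, (∑ v, if χ v = i then x v else 0) = z i := fun i =>
    (Finset.sum_filter _ _).symm
  have hzsum : ∑ v, x v = ∑ i, z i := by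
    rw [← sum_fiber_sums χ x]
    exact Finset.sum_congr rfl fun i _ => hz2 i
  simp only [hz2, hzsum] at hχ
  rw [hysum] at hform
  linarith

/-- The all-ones vector is tested, which bounds the radius below by twice the edge count over
n^(2/p). -/
theorem le_pSpectralRadius_turanGraph {p : ℝ} (hp : 1 ≤ p) {n r : ℕ} (hn : 0 < n) (hr : 0 < r) :
    (1 - 1 / (r : ℝ) - ((r : ℝ) ^ 2 + 2) / (n : ℝ) ^ 2) * (n : ℝ) ^ (2 - 2 / p) ≤
      pSpectralRadius p (SimpleGraph.turanGraph n r) := by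
  classical
  have hp0 : 0 < p := by linarith
  have hn0 : (0 : ℝ) < n := by exact_mod_cast hn
  have hr0 : (0 : ℝ) < r := by exact_mod_cast hr
  have h1 := graphForm_le_pSpectralRadius_mul hp (SimpleGraph.turanGraph n r) (fun _ => 1)
  have h2 : graphForm (SimpleGraph.turanGraph n r) (fun _ => 1) =
      2 * ((SimpleGraph.turanGraph n r).edgeFinset.card : ℝ) := by
    have h4 : ∀ e : Sym2 (Fin n), Sym2.lift ⟨fun _ _ : Fin n => (1 : ℝ) * 1,
        fun _ _ => mul_comm _ _⟩ e = 1 := fun e => by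
      induction e using Sym2.ind with
      | _ a b => simp
    rw [Finset.card_eq_sum_ones, Nat.cast_sum, Nat.cast_one]
    exact congrArg (2 * ·) (Finset.sum_congr (by congr!) fun e _ => h4 e)
  have h3 : (1 - 1 / (r : ℝ)) * (n : ℝ) ^ 2 - ((r : ℝ) ^ 2 + 2) ≤
      2 * ((SimpleGraph.turanGraph n r).edgeFinset.card : ℝ) := by
    rw [SimpleGraph.card_edgeFinset_turanGraph]
    push_cast
    set ρ := n % r with hρ
    have hρn : ρ ≤ n := Nat.mod_le _ _
    have hρr : (ρ : ℝ) ≤ r := by exact_mod_cast (Nat.mod_lt n hr).le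
    set X := (n ^ 2 - ρ ^ 2) * (r - 1) with hX
    have hXr : (X : ℝ) = ((n : ℝ) ^ 2 - (ρ : ℝ) ^ 2) * (r - 1) := by
      rw [hX, Nat.cast_mul, Nat.cast_sub (Nat.pow_le_pow_left hρn 2), Nat.cast_sub hr]
      push_cast
      ring
    -- The integer division loses less than one edge, whence the 2 in the error term; the r² absorbs
    -- ρ².
    have h5 : X < (X / (2 * r) + 1) * (2 * r) := Nat.lt_mul_of_div_lt (Nat.lt_succ_self _)
      (by omega)
    have h6 : (X : ℝ) < ((X / (2 * r) : ℕ) + 1) * (2 * r) := by exact_mod_cast h5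
    have h7 : (X : ℝ) / r < ((X / (2 * r) : ℕ) + 1) * 2 := by
      rw [div_lt_iff₀ hr0]
      linarith
    have h8 : (X : ℝ) / r = (1 - 1 / (r : ℝ)) * ((n : ℝ) ^ 2 - (ρ : ℝ) ^ 2) := by
      rw [hXr]
      field_simp
    have h9 : (0 : ℝ) ≤ 1 / (r : ℝ) := by positivity
    have h10 : (ρ : ℝ) ^ 2 ≤ (r : ℝ) ^ 2 := pow_le_pow_left₀ (Nat.cast_nonneg _) hρr 2
    have h11 : (0 : ℝ) ≤ (ρ.choose 2 : ℕ) := Nat.cast_nonneg _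
    have h12 : 0 ≤ 1 / (r : ℝ) * (ρ : ℝ) ^ 2 := by positivity
    rw [h8] at h7
    nlinarith
  rw [h2] at h1
  simp only [abs_one, Real.one_rpow, Finset.sum_const, Finset.card_univ, Fintype.card_fin,
    nsmul_eq_mul, mul_one] at h1
  have hpos : 0 < (n : ℝ) ^ (2 / p) := Real.rpow_pos_of_pos hn0 _
  rw [Real.rpow_sub hn0, ← mul_div_assoc, div_le_iff₀ hpos]
  refine le_trans (le_of_eq ?_) (h3.trans h1)
  have : (n : ℝ) ^ (2 : ℝ) = (n : ℝ) ^ 2 := Real.rpow_natCast _ 2 ▸ by norm_num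
  rw [this]
  field_simp

/-! ### Deleting vertices of small weight -/

/-- If a vertex has small degree then the smallest entry of a maximizer is well below average. -/
theorem rpow_min_entry_le {V : Type*} [Fintype V] {p : ℝ} (hp : 1 < p)
    (G : SimpleGraph V) [DecidableRel G.Adj] {x : V → ℝ} (hx : ∀ i, 0 ≤ x i)
    (hx1 : ∑ i, x i ^ p = 1) (hG : graphForm G x = pSpectralRadius p G) {k u : V}
    (hk : ∀ i, x k ≤ x i) {A B η : ℝ} (hB : 0 ≤ B) (hη : 0 < η) (hη1 : η < 1)
    (hA : 0 < A) (hAB : B ≤ A * (1 - η)) (hAB' : B + η < A)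
    (hdeg : ((Finset.univ.filter fun j => G.Adj u j).card : ℝ) ≤ B * Fintype.card V)
    (hl : A * (Fintype.card V : ℝ) ^ (2 - 2 / p) ≤ pSpectralRadius p G) :
    x k ^ p ≤ (1 - η) / Fintype.card V := by
  classical
  by_contra! hs
  set m : ℝ := (Fintype.card V : ℝ) with hm
  have hm0 : 0 < m := by
    have : 0 < Fintype.card V := Fintype.card_pos_iff.2 ⟨u⟩
    rw [hm]
    exact_mod_cast this
  set s := x k ^ p with hs'
  set N := Finset.univ.filter fun j => G.Adj u j with hN
  set T := ∑ j ∈ N, x j ^ p with hT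
  have hp0 : 0 < p := by linarith
  have hD : nbrSum G x u = ∑ j ∈ N, x j := by
    rw [nbrSum, hN, Finset.sum_filter]
    exact Finset.sum_congr rfl fun j _ => by congr
  have hT0 : 0 ≤ T := Finset.sum_nonneg fun j _ => Real.rpow_nonneg (hx j) _
  -- Each vertex outside N carries at least s > (1 - η)/m, so T ≤ 1 - (1 - B)(1 - η) ≤ B + η.
  have hTle : T ≤ B + η := by
    have h1 : T + ∑ j ∈ Nᶜ, x j ^ p = 1 := by rw [← hx1, hT, Finset.sum_add_sum_compl]
    have h2 : ((Nᶜ).card : ℝ) * s ≤ ∑ j ∈ Nᶜ, x j ^ p := by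
      rw [← nsmul_eq_mul]
      exact Finset.card_nsmul_le_sum _ _ _ fun j _ =>
        Real.rpow_le_rpow (hx k) (hk j) hp0.le
    have h3 : ((Nᶜ).card : ℝ) = m - N.card := by
      rw [Finset.card_compl, Nat.cast_sub (Finset.card_le_univ _)]
    have h4 : (1 - B) * m ≤ m - N.card := by linarith
    have h5 : ((1 - B) * m) * ((1 - η) / m) ≤ (m - N.card) * s := by
      have : (0 : ℝ) ≤ m - N.card := by rw [← h3]; exact Nat.cast_nonneg _
      exact mul_le_mul h4 hs.le (div_nonneg (by linarith) hm0.le) this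
    have h6 : ((1 - B) * m) * ((1 - η) / m) = (1 - B) * (1 - η) := by field_simp
    rw [h3] at h2
    have h7 : 0 ≤ η * B := mul_nonneg hη.le hB
    nlinarith
  -- Stationarity at u makes this an upper bound for (λ x_u^(p-1))^p, while x u ≥ x k bounds the
  -- same quantity below. Comparing the two contradicts the gaps between A and B.
  have h1 := Real.rpow_sum_le_const_mul_sum_rpow_of_nonneg N hp.le (fun i _ => hx i)
  rw [← hD, nbrSum_eq_of_maximizer hp G hx hx1 hG u] at h1
  have hl0 := pSpectralRadius_nonneg hp.le G
  have hxu : 0 ≤ x u ^ (p - 1) := Real.rpow_nonneg (hx u) _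
  have h2 : (A * m ^ (2 - 2 / p)) ^ p * ((1 - η) / m) ^ (p - 1) ≤
      (pSpectralRadius p G * x u ^ (p - 1)) ^ p := by
    rw [Real.mul_rpow hl0 hxu, ← Real.rpow_mul (hx u), mul_comm (p - 1) p,
      Real.rpow_mul (hx u)]
    refine mul_le_mul (Real.rpow_le_rpow (by positivity) hl hp0.le) ?_
      (Real.rpow_nonneg (div_nonneg (by linarith) hm0.le) _) (Real.rpow_nonneg hl0 _)
    refine Real.rpow_le_rpow (div_nonneg (by linarith) hm0.le) (hs.le.trans ?_) (by linarith)
    exact Real.rpow_le_rpow (hx k) (hk u) hp0.le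
  have h3 : (N.card : ℝ) ^ (p - 1) * T ≤ (B * m) ^ (p - 1) * (B + η) :=
    mul_le_mul (Real.rpow_le_rpow (Nat.cast_nonneg _) hdeg (by linarith)) hTle hT0
      (Real.rpow_nonneg (mul_nonneg hB hm0.le) _)
  have h4 : (A * m ^ (2 - 2 / p)) ^ p * ((1 - η) / m) ^ (p - 1) =
      m ^ (p - 1) * ((A * (1 - η)) ^ (p - 1) * A) := by
    have e1 : A ^ p = A ^ (p - 1) * A := by rw [← Real.rpow_add_one hA.ne', sub_add_cancel]
    have e2 : (m ^ (2 - 2 / p)) ^ p = m ^ (p - 1) * m ^ (p - 1) := by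
      rw [← Real.rpow_mul hm0.le, ← Real.rpow_add hm0]
      congr 1
      field_simp
      ring
    have e3 : 0 < m ^ (p - 1) := Real.rpow_pos_of_pos hm0 _
    rw [Real.mul_rpow hA.le (Real.rpow_nonneg hm0.le _), e2, e1,
      Real.div_rpow (by linarith) hm0.le, Real.mul_rpow hA.le (by linarith)]
    field_simp
  have h5 : m ^ (p - 1) * ((A * (1 - η)) ^ (p - 1) * A) ≤ m ^ (p - 1) * (B ^ (p - 1) * (B + η)) := by
    rw [← h4]
    refine (h2.trans (h1.trans h3)).trans (le_of_eq ?_)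
    rw [Real.mul_rpow hB hm0.le]
    ring
  have h6 := le_of_mul_le_mul_left h5 (Real.rpow_pos_of_pos hm0 _)
  have h7 : B ^ (p - 1) ≤ (A * (1 - η)) ^ (p - 1) := Real.rpow_le_rpow hB hAB (by linarith)
  have h8 : 0 < (A * (1 - η)) ^ (p - 1) :=
    Real.rpow_pos_of_pos (mul_pos hA (by linarith)) _
  have h9 : B ^ (p - 1) * (B + η) < (A * (1 - η)) ^ (p - 1) * A :=
    lt_of_le_of_lt (mul_le_mul_of_nonneg_right h7 (by linarith))
      (mul_lt_mul_of_pos_left hAB' h8)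
  linarith

/-- The analytic core of a deletion, with s = x_k^p: the form keeps a factor 1 - 2s and the squared
p-norm a factor (1 - s)^(2/p). The gain η in s pays for κ and for the second-order terms 8/m. -/
theorem rpow_mul_rpow_le_one_sub {p κ η m s : ℝ} (hp : 0 < p) (hm : 4 ≤ m) (hs : 0 ≤ s)
    (hη : 0 ≤ η) (hsm : s ≤ (1 - η) / m) (hq : 0 ≤ 2 - 2 / p) (hκq : κ ≤ 2 - 2 / p)
    (hκ : κ + 8 / m ≤ (2 - 2 / p) * η) :
    (1 - s) ^ (2 / p) * ((m - 1) / m) ^ (2 - 2 / p - κ) ≤ 1 - 2 * s := by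
  have hm0 : 0 < m := by linarith
  have hs1 : s ≤ 1 / m := hsm.trans (by gcongr; linarith)
  have hm4 : 1 / m ≤ 1 / 4 := one_div_le_one_div_of_le (by norm_num) hm
  have h1 : (1 - s) ^ (2 / p) ≤ Real.exp (-s * (2 / p)) := by
    rw [Real.exp_mul]
    exact Real.rpow_le_rpow (by linarith) (Real.one_sub_le_exp_neg s) (by positivity)
  have h2 : ((m - 1) / m) ^ (2 - 2 / p - κ) ≤ Real.exp (-(1 / m) * (2 - 2 / p - κ)) := by
    rw [Real.exp_mul]
    refine Real.rpow_le_rpow (div_nonneg (by linarith) hm0.le) ?_ (by linarith)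
    rw [sub_div, div_self hm0.ne']
    exact Real.one_sub_le_exp_neg _
  have h3 : Real.exp (-s * (2 / p)) * Real.exp (-(1 / m) * (2 - 2 / p - κ)) ≤
      Real.exp (-(2 * s + 8 * s ^ 2)) := by
    rw [← Real.exp_add]
    refine Real.exp_le_exp.2 ?_
    have e1 : (2 - 2 / p) * s ≤ (2 - 2 / p) * ((1 - η) / m) := mul_le_mul_of_nonneg_left hsm hq
    have e2 : 8 * s ^ 2 ≤ 8 / m * (1 / m) := by
      have : s ^ 2 ≤ (1 / m) ^ 2 := pow_le_pow_left₀ hs hs1 2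
      calc 8 * s ^ 2 ≤ 8 * (1 / m) ^ 2 := by linarith
        _ = _ := by ring
    have e3 := mul_le_mul_of_nonneg_right hκ (show 0 ≤ 1 / m by positivity)
    have e4 : (2 - 2 / p) * ((1 - η) / m) = (2 - 2 / p) * (1 / m) - (2 - 2 / p) * η * (1 / m) := by
      ring
    linarith
  -- Uses exp y ≥ 1 + y and (1 + 2s + 8s²)(1 - 2s) = 1 + 4s²(1 - 4s), where s ≤ 1/4.
  have h4 : Real.exp (-(2 * s + 8 * s ^ 2)) ≤ 1 - 2 * s := by
    rw [Real.exp_neg]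
    have e1 : 1 + (2 * s + 8 * s ^ 2) ≤ Real.exp (2 * s + 8 * s ^ 2) := by
      linarith [Real.add_one_le_exp (2 * s + 8 * s ^ 2)]
    have e2 : 0 < 1 - 2 * s := by linarith
    rw [inv_le_comm₀ (Real.exp_pos _) e2]
    refine le_trans ?_ e1
    rw [inv_le_iff_one_le_mul₀ e2]
    have e3 : 0 ≤ s ^ 2 * (1 / 4 - s) := mul_nonneg (sq_nonneg s) (by linarith)
    nlinarith
  calc _ ≤ Real.exp (-s * (2 / p)) * Real.exp (-(1 / m) * (2 - 2 / p - κ)) :=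
        mul_le_mul h1 h2 (Real.rpow_nonneg (div_nonneg (by linarith) hm0.le) _) (Real.exp_pos _).le
    _ ≤ _ := h3.trans h4

theorem graphForm_comap_ne {V : Type*} [Fintype V] [DecidableEq V] (G : SimpleGraph V) (x : V → ℝ)
    (k : V) :
    graphForm (G.comap (Subtype.val : {i // i ≠ k} → V)) (fun i => x i) =
      graphForm G x - 2 * x k * nbrSum G x k := by
  classical
  have h := graphForm_add_single G x k (-x k)
  set y : V → ℝ := fun j => x j + -x k * (Pi.single k (1 : ℝ) : V → ℝ) j with hy
  have hyk : y k = 0 := by simp [hy]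
  have hyo : ∀ i : {i // i ≠ k}, y i = x i := fun i => by simp [hy, i.2]
  have h1 : graphForm G y =
      graphForm (G.comap (Subtype.val : {i // i ≠ k} → V)) (fun i => x i) := by
    rw [graphForm_eq_sum_nbrSum, graphForm_eq_sum_nbrSum, Fintype.sum_eq_add_sum_subtype_ne _ k,
      hyk, zero_mul, zero_add]
    refine Finset.sum_congr rfl fun i _ => ?_
    rw [hyo, nbrSum, nbrSum, Fintype.sum_eq_add_sum_subtype_ne _ k, hyk, ite_self, zero_add]
    congr 1
    refine Finset.sum_congr rfl fun j _ => ?_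
    rw [hyo]
    simp only [SimpleGraph.comap_adj]
  rw [← h1, h]
  ring

/-- Deleting a vertex of smallest weight when some vertex has small degree. -/
theorem exists_vertex_deletion {V : Type*} [Fintype V] [DecidableEq V] {p : ℝ} (hp : 1 < p)
    (G : SimpleGraph V) [DecidableRel G.Adj] {u : V} {A B η κ : ℝ} (hB : 0 ≤ B) (hη : 0 < η)
    (hη1 : η < 1) (hA : 0 < A) (hAB : B ≤ A * (1 - η)) (hAB' : B + η < A)
    (hdeg : ((Finset.univ.filter fun j => G.Adj u j).card : ℝ) ≤ B * Fintype.card V)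
    (hl : A * (Fintype.card V : ℝ) ^ (2 - 2 / p) ≤ pSpectralRadius p G)
    (hm : (4 : ℝ) ≤ Fintype.card V) (hκ : κ + 8 / Fintype.card V ≤ (2 - 2 / p) * η) :
    ∃ k : V, pSpectralRadius p G *
      (((Fintype.card V : ℝ) - 1) / Fintype.card V) ^ (2 - 2 / p - κ) ≤
      pSpectralRadius p (G.comap (Subtype.val : {i // i ≠ k} → V)) := by
  classical
  have hp0 : 0 < p := by linarith
  have : Nonempty V := ⟨u⟩
  obtain ⟨x, hx, hx1, hG⟩ := exists_nonneg_maximizer hp.le G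
  obtain ⟨k, -, hk⟩ := Finset.exists_min_image Finset.univ x ⟨u, Finset.mem_univ u⟩
  refine ⟨k, ?_⟩
  have hs := rpow_min_entry_le hp G hx hx1 hG (fun i => hk i (Finset.mem_univ i)) hB hη hη1 hA hAB
    hAB' hdeg hl
  have hs0 : 0 ≤ x k ^ p := Real.rpow_nonneg (hx k) _
  have hm0 : (0 : ℝ) < Fintype.card V := by linarith
  have hq : 0 ≤ 2 - 2 / p := by
    rw [sub_nonneg, div_le_iff₀ hp0]
    linarith
  have h8 : (0 : ℝ) < 8 / Fintype.card V := by positivity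
  have hκq : κ ≤ 2 - 2 / p := by nlinarith
  have h1 := rpow_mul_rpow_le_one_sub hp0 hm hs0 hη.le hs hq hκq hκ
  have hs1 : x k ^ p < 1 := by
    refine hs.trans_lt ?_
    rw [div_lt_one hm0]
    linarith
  have h2 := graphForm_le_pSpectralRadius_mul hp.le
    (G.comap (Subtype.val : {i // i ≠ k} → V)) (fun i => x i)
  have h3 : ∑ i : {i // i ≠ k}, |x i| ^ p = 1 - x k ^ p := by
    rw [Fintype.sum_eq_add_sum_subtype_ne _ k] at hx1
    rw [← hx1, add_sub_cancel_left]
    exact Finset.sum_congr rfl fun i _ => by rw [abs_of_nonneg (hx i)]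
  have h4 : x k * x k ^ (p - 1) = x k ^ p := by
    rcases (hx k).eq_or_lt with h0 | hpos
    · rw [← h0, zero_mul, Real.zero_rpow hp0.ne']
    · rw [mul_comm, ← Real.rpow_add_one hpos.ne', sub_add_cancel]
  rw [graphForm_comap_ne, nbrSum_eq_of_maximizer hp G hx hx1 hG k, hG, h3] at h2
  have h5 : 0 < (1 - x k ^ p) ^ (2 / p) := Real.rpow_pos_of_pos (by linarith) _
  refine le_of_mul_le_mul_right (le_trans ?_ h2) h5
  have h6 := mul_le_mul_of_nonneg_left h1 (pSpectralRadius_nonneg hp.le G)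
  calc _ = pSpectralRadius p G * ((1 - x k ^ p) ^ (2 / p) *
        (((Fintype.card V : ℝ) - 1) / Fintype.card V) ^ (2 - 2 / p - κ)) := by ring
    _ ≤ _ := h6
    _ = _ := by
      rw [← h4]
      ring

universe u

theorem isContained_comap_val {V : Type*} (G : SimpleGraph V) (s : V → Prop) :
    (G.comap (Subtype.val : {i // s i} → V)).IsContained G :=
  ⟨(SimpleGraph.Embedding.comap (Function.Embedding.subtype s) G).toCopy⟩

theorem card_subtype_ne_eq {V : Type*} [Fintype V] [DecidableEq V] (k : V) :
    Fintype.card {i // i ≠ k} = Fintype.card V - 1 := by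
  rw [Fintype.card_subtype, Finset.filter_ne', Finset.card_erase_of_mem (Finset.mem_univ _),
    Finset.card_univ]

/-- Losing one vertex gains a relative κ/(2n), since (1 - 1/n)^κ ≤ 1 - κ/(2n); this exceeds the
deficit K/n² of the Turán graph. -/
theorem not_mul_rpow_le_of_le_sub_one {A K κ n w : ℝ} (hA : 1 / 2 ≤ A) (hK : 0 < K)
    (hκ : 0 < κ) (hκ1 : κ ≤ 1) (hn : 1 ≤ n) (hKn : 4 * K < κ * n) (hw : 0 < w)
    (hwn : w ≤ n - 1) : ¬ (A - K / n ^ 2) * n ^ κ ≤ A * w ^ κ := by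
  intro h
  have hn0 : 0 < n := by linarith
  have h4 : w ^ κ ≤ n ^ κ * Real.exp (-(κ / n)) := by
    refine (Real.rpow_le_rpow hw.le hwn hκ.le).trans ?_
    have e1 : n - 1 ≤ n * Real.exp (-(1 / n)) := by
      have := mul_le_mul_of_nonneg_left (Real.one_sub_le_exp_neg (1 / n)) hn0.le
      refine le_trans (le_of_eq ?_) this
      field_simp
    refine (Real.rpow_le_rpow (by linarith) e1 hκ.le).trans (le_of_eq ?_)
    rw [Real.mul_rpow hn0.le (Real.exp_pos _).le, ← Real.exp_mul]
    congr 2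
    ring
  have h5 : Real.exp (-(κ / n)) ≤ 1 - κ / n / 2 := by
    have hy0 : 0 ≤ κ / n := by positivity
    have hy1 : κ / n ≤ 1 := by
      rw [div_le_one hn0]
      linarith
    rw [Real.exp_neg, inv_le_iff_one_le_mul₀ (Real.exp_pos _)]
    have := Real.add_one_le_exp (κ / n)
    nlinarith
  have h6 : n ^ κ * (A - K / n ^ 2) ≤ n ^ κ * (A * (1 - κ / n / 2)) := by
    calc n ^ κ * (A - K / n ^ 2) = (A - K / n ^ 2) * n ^ κ := mul_comm _ _
      _ ≤ A * w ^ κ := h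
      _ ≤ A * (n ^ κ * (1 - κ / n / 2)) := by
          refine mul_le_mul_of_nonneg_left (h4.trans ?_) (by linarith)
          exact mul_le_mul_of_nonneg_left h5 (Real.rpow_nonneg hn0.le _)
      _ = _ := by ring
  have h7 := le_of_mul_le_mul_left h6 (Real.rpow_pos_of_pos hn0 _)
  have h8 : A * (κ / n) / 2 ≤ K / n ^ 2 := by linarith
  rw [le_div_iff₀ (by positivity)] at h8
  have h9 : A * (κ / n) / 2 * n ^ 2 = A * (κ * n) / 2 := by
    field_simp
  rw [h9] at h8
  nlinarith

/-- Iterated deletion of vertices of smallest weight leads to a subgraph of large minimum degree,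
with no loss in the normalized `p`-spectral radius. -/
theorem exists_contained_large_degrees {p : ℝ} (hp : 1 < p) {A B η κ L N : ℝ} (hB : 0 ≤ B)
    (hη : 0 < η) (hη1 : η < 1) (hA : 0 < A) (hAB : B ≤ A * (1 - η)) (hAB' : B + η < A)
    (hκ : 0 ≤ κ) (hLN : A * N ^ κ ≤ L)
    (hM : ∀ m : ℕ, 0 < m → L ≤ (m : ℝ) ^ κ →
      (4 : ℝ) ≤ m ∧ κ + 8 / (m : ℝ) ≤ (2 - 2 / p) * η) (n : ℕ) :
    ∀ (V : Type u) [Fintype V] (G : SimpleGraph V), Fintype.card V = n → 0 < n → (n : ℝ) ≤ N →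
      L * (n : ℝ) ^ (2 - 2 / p - κ) ≤ pSpectralRadius p G →
      ∃ (W : Type u) (_ : Fintype W) (H : SimpleGraph W), H.IsContained G ∧ Fintype.card W ≤ n ∧
        0 < Fintype.card W ∧
        L * (Fintype.card W : ℝ) ^ (2 - 2 / p - κ) ≤ pSpectralRadius p H ∧
        ∀ [DecidableRel H.Adj] (u : W), B * Fintype.card W <
          ((Finset.univ.filter fun j => H.Adj u j).card : ℝ) := by
  classical
  induction n with
  | zero => intro V _ G _ h0; exact absurd h0 (lt_irrefl 0)
  | succ n ih =>
    intro V _ G hV h0 hnN hL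
    by_cases hdeg : ∃ u, ((Finset.univ.filter fun j => G.Adj u j).card : ℝ) ≤ B * Fintype.card V
    · obtain ⟨u, hu⟩ := hdeg
      set m : ℝ := ((n + 1 : ℕ) : ℝ) with hm
      have hm0 : 0 < m := by rw [hm]; exact_mod_cast h0
      -- The trivial bound λ ≤ m^q keeps m from getting small, so `hM` always applies.
      have hLm : L ≤ m ^ κ := by
        have h1 := hL.trans (pSpectralRadius_le_card_rpow hp.le G)
        rw [hV, ← hm] at h1
        have h2 : m ^ (2 - 2 / p) = m ^ κ * m ^ (2 - 2 / p - κ) := by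
          rw [← Real.rpow_add hm0]
          congr 1
          ring
        rw [h2] at h1
        exact le_of_mul_le_mul_right h1 (Real.rpow_pos_of_pos hm0 _)
      obtain ⟨hm4, hκm⟩ := hM (n + 1) h0 hLm
      have hl : A * (Fintype.card V : ℝ) ^ (2 - 2 / p) ≤ pSpectralRadius p G := by
        refine le_trans ?_ hL
        rw [hV, ← hm]
        have h2 : m ^ (2 - 2 / p) = m ^ κ * m ^ (2 - 2 / p - κ) := by
          rw [← Real.rpow_add hm0]
          congr 1
          ring
        rw [h2, ← mul_assoc]
        refine mul_le_mul_of_nonneg_right ?_ (Real.rpow_nonneg hm0.le _)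
        exact (mul_le_mul_of_nonneg_left (Real.rpow_le_rpow hm0.le hnN hκ) hA.le).trans hLN
      obtain ⟨k, hk⟩ := exists_vertex_deletion hp G hB hη hη1 hA hAB hAB' hu hl
        (by rw [hV]; exact hm4) (by rw [hV]; exact hκm)
      have hcard : Fintype.card {i // i ≠ k} = n := by
        rw [card_subtype_ne_eq, hV, Nat.add_sub_cancel]
      have hn1 : (1 : ℝ) ≤ n := by
        have : m = n + 1 := by rw [hm]; push_cast; ring
        linarith
      have hL' : L * (n : ℝ) ^ (2 - 2 / p - κ) ≤
          pSpectralRadius p (G.comap (Subtype.val : {i // i ≠ k} → V)) := by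
        refine le_trans ?_ hk
        rw [hV, ← hm]
        have h1 : m - 1 = n := by rw [hm]; push_cast; ring
        rw [h1, Real.div_rpow (by linarith) hm0.le]
        have h3 : 0 < m ^ (2 - 2 / p - κ) := Real.rpow_pos_of_pos hm0 _
        rw [← mul_div_assoc, le_div_iff₀ h3]
        calc _ = (L * m ^ (2 - 2 / p - κ)) * (n : ℝ) ^ (2 - 2 / p - κ) := by ring
          _ ≤ _ := mul_le_mul_of_nonneg_right hL (Real.rpow_nonneg (by linarith) _)
      obtain ⟨W, i1, H, hHG, hWn, hW0, hLH, hHdeg⟩ := ih {i // i ≠ k} _ hcard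
        (by exact_mod_cast hn1) (by rw [hm] at hnN; push_cast at hnN; linarith) hL'
      exact ⟨W, i1, H, hHG.trans (isContained_comap_val G _), by omega, hW0, hLH, hHdeg⟩
    · push Not at hdeg
      refine ⟨V, inferInstance, G, SimpleGraph.IsContained.refl G, hV.le, by omega, by rw [hV]; exact hL, ?_⟩
      intro _ u
      refine (hdeg u).trans_le (le_of_eq ?_)
      congr!

-- The deletion is run with ε = 1/r^6, η = ε/2 and κ = qε/4, so that qη = 2κ leaves one κ to cover
-- 8/m. The hypothesis on log n gives κ log n ≥ 2 r^14.
set_option maxHeartbeats 1000000 in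
theorem exists_contained_clique_large_degrees {p : ℝ} (hp : 1 < p) {r n : ℕ} (hr : 2 ≤ r)
    (hn : 0 < n) (hlog : 8 * (r : ℝ) ^ 20 ≤ (2 - 2 / p) * Real.log n) {V : Type u} [Fintype V]
    (G : SimpleGraph V) (hV : Fintype.card V = n)
    (hG : pSpectralRadius p (SimpleGraph.turanGraph n r) < pSpectralRadius p G) :
    ∃ (W : Type u) (_ : Fintype W) (H : SimpleGraph W), H.IsContained G ∧
      (n : ℝ) ^ (1 / 2 : ℝ) ≤ Fintype.card W ∧ ¬ H.CliqueFree (r + 1) ∧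
      ∀ [DecidableRel H.Adj] (u : W), (1 - 1 / (r : ℝ) - 1 / (r : ℝ) ^ 6) * Fintype.card W <
          ((Finset.univ.filter fun j => H.Adj u j).card : ℝ) := by
  classical
  have hr2 : (2 : ℝ) ≤ r := by exact_mod_cast hr
  have hn0 : (0 : ℝ) < n := by exact_mod_cast hn
  have hn1 : (1 : ℝ) ≤ n := by exact_mod_cast hn
  set q := 2 - 2 / p with hq
  have hq2 : q ≤ 2 := by
    have : 0 < 2 / p := by positivity
    linarith
  have hq0 : 0 < q := by
    rw [hq, sub_pos, div_lt_iff₀ (by linarith)]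
    linarith
  set ε : ℝ := 1 / (r : ℝ) ^ 6 with hε
  have hε0 : 0 < ε := by positivity
  have hr6 : (64 : ℝ) ≤ (r : ℝ) ^ 6 := by
    have := pow_le_pow_left₀ (by norm_num) hr2 6
    linarith
  have hr14 : (16384 : ℝ) ≤ (r : ℝ) ^ 14 := by
    have := pow_le_pow_left₀ (by norm_num) hr2 14
    linarith
  have hε1 : ε ≤ 1 / 64 := one_div_le_one_div_of_le (by norm_num) hr6
  have hεr : ε * (r : ℝ) ^ 20 = (r : ℝ) ^ 14 := by
    rw [hε]
    field_simp
  have hr1 : 1 / (r : ℝ) ≤ 1 / 2 := one_div_le_one_div_of_le (by norm_num) hr2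
  set A0 := 1 - 1 / (r : ℝ) with hA0
  have hA01 : A0 ≤ 1 := by
    have : 0 < 1 / (r : ℝ) := by positivity
    linarith
  set κ := q * ε / 4 with hκ
  have hκ0 : 0 < κ := by positivity
  set l := Real.log n with hl
  have hκl : 2 * (r : ℝ) ^ 14 ≤ κ * l := by
    rw [hκ, ← hεr]
    have := mul_le_mul_of_nonneg_left hlog hε0.le
    linarith
  have hl0 : 0 < l := by
    by_contra! h
    have := mul_nonpos_of_nonneg_of_nonpos hκ0.le h
    linarith
  have hln : l ≤ n := (Real.log_le_sub_one_of_pos hn0).trans (by linarith)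
  have hKr : 2 * ((r : ℝ) ^ 2 + 2) < (r : ℝ) ^ 14 := by
    have : (r : ℝ) ^ 14 = (r : ℝ) ^ 2 * (r : ℝ) ^ 12 := by ring
    have h12 : (4096 : ℝ) ≤ (r : ℝ) ^ 12 := by
      have := pow_le_pow_left₀ (by norm_num) hr2 12
      linarith
    nlinarith
  have hK : 0 < (r : ℝ) ^ 2 + 2 := by positivity
  have hA0half : 1 / 2 ≤ A0 := by linarith
  have hκε : κ ≤ ε / 2 := by
    have := mul_le_mul_of_nonneg_right hq2 hε0.le
    rw [hκ]
    linarith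
  have hκ1 : κ ≤ 1 := by linarith
  have hκln : κ * l ≤ κ * n := mul_le_mul_of_nonneg_left hln hκ0.le
  have hκn : 4 * ((r : ℝ) ^ 2 + 2) < κ * n := by linarith
  have hKε : ((r : ℝ) ^ 2 + 2) / (n : ℝ) ^ 2 ≤ ε / 4 := by
    rw [div_le_iff₀ (by positivity)]
    have h1 : κ * n ≤ κ * (n : ℝ) ^ 2 := by
      refine mul_le_mul_of_nonneg_left ?_ hκ0.le
      exact le_self_pow₀ hn1 (by norm_num)
    have h2 := mul_le_mul_of_nonneg_right hκε (show (0 : ℝ) ≤ (n : ℝ) ^ 2 by positivity)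
    linarith
  have hlow := le_pSpectralRadius_turanGraph hp.le hn (by omega : 0 < r)
  set μ := A0 - ((r : ℝ) ^ 2 + 2) / (n : ℝ) ^ 2 with hμ
  have hμA : A0 - ε / 4 ≤ μ := by linarith
  set L := μ * (n : ℝ) ^ κ with hL
  have hsplit : ∀ m : ℝ, 0 < m → m ^ q = m ^ κ * m ^ (q - κ) := fun m hm => by
    rw [← Real.rpow_add hm]
    congr 1
    ring
  have hLG : L * (n : ℝ) ^ (q - κ) ≤ pSpectralRadius p G := by
    rw [hL, mul_assoc, ← hsplit _ hn0]
    exact hlow.trans hG.le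
  have hLN : (A0 - ε / 4) * (n : ℝ) ^ κ ≤ L :=
    mul_le_mul_of_nonneg_right hμA (Real.rpow_nonneg hn0.le _)
  -- Here L ≥ n^κ/4 and n^(κ/2) ≥ 4, hence n^(κ/2) ≤ L ≤ m^κ.
  have hsqrt : ∀ m : ℕ, 0 < m → L ≤ (m : ℝ) ^ κ → (n : ℝ) ^ (1 / 2 : ℝ) ≤ m := by
    intro m hm hLm
    rw [← Real.rpow_le_rpow_iff (Real.rpow_nonneg hn0.le _) (Nat.cast_nonneg m) hκ0,
      ← Real.rpow_mul hn0.le]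
    have h1 : (n : ℝ) ^ κ = (n : ℝ) ^ (1 / 2 * κ) * (n : ℝ) ^ (1 / 2 * κ) := by
      rw [← Real.rpow_add hn0]
      congr 1
      ring
    have h2 : 4 ≤ (n : ℝ) ^ (1 / 2 * κ) := by
      rw [Real.rpow_def_of_pos hn0, ← hl]
      have := Real.add_one_le_exp (l * (1 / 2 * κ))
      linarith
    have h3 : (n : ℝ) ^ (1 / 2 * κ) * 4 ≤ (n : ℝ) ^ κ := by
      rw [h1]
      exact mul_le_mul_of_nonneg_left h2 (by linarith)
    have h4 : 1 / 4 * (n : ℝ) ^ κ ≤ L :=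
      (mul_le_mul_of_nonneg_right (by linarith) (Real.rpow_nonneg hn0.le _)).trans hLN
    linarith
  have hM : ∀ m : ℕ, 0 < m → L ≤ (m : ℝ) ^ κ → (4 : ℝ) ≤ m ∧ κ + 8 / (m : ℝ) ≤ q * (ε / 2) := by
    intro m hm hLm
    have h1 := hsqrt m hm hLm
    have h2 : l / 2 ≤ m := by
      refine le_trans ?_ h1
      rw [Real.rpow_def_of_pos hn0, ← hl]
      have := Real.add_one_le_exp (l * (1 / 2))
      linarith
    have hm0 : (0 : ℝ) < m := by exact_mod_cast hm
    have h3 : (r : ℝ) ^ 14 ≤ κ * m := by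
      have := mul_le_mul_of_nonneg_left h2 hκ0.le
      linarith
    constructor
    · have := mul_le_of_le_one_left hm0.le hκ1
      linarith
    · have h4 : 8 / (m : ℝ) ≤ κ := by
        rw [div_le_iff₀ hm0]
        linarith
      have : q * (ε / 2) = 2 * κ := by rw [hκ]; ring
      linarith
  -- The first deletion is made by hand: it ensures an order of at most n - 1, which the crude
  -- clique-free bound requires.
  by_cases hdeg : ∃ u, ((Finset.univ.filter fun j => G.Adj u j).card : ℝ) ≤
      (A0 - ε) * Fintype.card V
  · obtain ⟨u, hu⟩ := hdeg
    have hB : 0 ≤ A0 - ε := by linarith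
    have hA : 0 < A0 - ε / 4 := by linarith
    have hAB : A0 - ε ≤ (A0 - ε / 4) * (1 - ε / 2) := by nlinarith
    have hAB' : A0 - ε + ε / 2 < A0 - ε / 4 := by linarith
    have hη : 0 < ε / 2 := by linarith
    have hη1 : ε / 2 < 1 := by linarith
    have hLn : L ≤ (n : ℝ) ^ κ := by
      have h1 := hLG.trans (pSpectralRadius_le_card_rpow hp.le G)
      rw [hV, ← hq, hsplit _ hn0] at h1
      exact le_of_mul_le_mul_right h1 (Real.rpow_pos_of_pos hn0 _)
    obtain ⟨hn4, hκn8⟩ := hM n hn hLn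
    obtain ⟨k, hk⟩ := exists_vertex_deletion (κ := κ) hp G hB hη hη1 hA hAB hAB' hu
      (by
        rw [hV, ← hq]
        exact (mul_le_mul_of_nonneg_right hμA (Real.rpow_nonneg hn0.le _)).trans
          (hlow.trans hG.le))
      (by rw [hV]; exact hn4) (by rw [hV, ← hq]; exact hκn8)
    have hcard : Fintype.card {i // i ≠ k} = n - 1 := by
      rw [card_subtype_ne_eq, hV]
    have hn1' : ((n - 1 : ℕ) : ℝ) = n - 1 := by
      rw [Nat.cast_sub hn, Nat.cast_one]
    have hL' : L * ((n - 1 : ℕ) : ℝ) ^ (q - κ) ≤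
        pSpectralRadius p (G.comap (Subtype.val : {i // i ≠ k} → V)) := by
      refine le_trans ?_ hk
      rw [hV, hn1', Real.div_rpow (by linarith) hn0.le]
      have h3 : 0 < (n : ℝ) ^ (q - κ) := Real.rpow_pos_of_pos hn0 _
      rw [← mul_div_assoc, le_div_iff₀ h3]
      calc _ = (L * (n : ℝ) ^ (q - κ)) * ((n : ℝ) - 1) ^ (q - κ) := by ring
        _ ≤ _ := mul_le_mul_of_nonneg_right hLG (Real.rpow_nonneg (by linarith) _)
    have hn1pos : 0 < n - 1 := by
      have : (0 : ℝ) < ((n - 1 : ℕ) : ℝ) := by rw [hn1']; linarith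
      exact_mod_cast this
    obtain ⟨W, i1, H, hHG, hWn, hW0, hLH, hHdeg⟩ := exists_contained_large_degrees hp
      (N := n) hB hη hη1 hA hAB hAB' hκ0.le hLN hM (n - 1) {i // i ≠ k} _ hcard
      hn1pos (by rw [hn1']; linarith) hL'
    have hW0' : (0 : ℝ) < Fintype.card W := by exact_mod_cast hW0
    refine ⟨W, i1, H, hHG.trans (isContained_comap_val G _), ?_, ?_, fun u => ?_⟩
    · refine hsqrt _ hW0 ?_
      have h1 := hLH.trans (pSpectralRadius_le_card_rpow hp.le H)
      rw [← hq, hsplit _ hW0'] at h1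
      exact le_of_mul_le_mul_right h1 (Real.rpow_pos_of_pos hW0' _)
    · intro hfree
      have h1 := hLH.trans (pSpectralRadius_le_of_cliqueFree hp.le H (by omega) hfree)
      rw [← hq, hsplit _ hW0', ← mul_assoc] at h1
      have h2 := le_of_mul_le_mul_right h1 (Real.rpow_pos_of_pos hW0' _)
      have h3 : (Fintype.card W : ℝ) ≤ n - 1 := by
        rw [← hn1']
        exact_mod_cast hWn
      exact not_mul_rpow_le_of_le_sub_one hA0half hK hκ0 hκ1 hn1 hκn hW0' h3 h2
    · exact hHdeg u
  · push Not at hdeg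
    refine ⟨V, inferInstance, G, SimpleGraph.IsContained.refl G, ?_, ?_, fun u => ?_⟩
    · rw [hV]
      calc (n : ℝ) ^ (1 / 2 : ℝ) ≤ (n : ℝ) ^ (1 : ℝ) :=
            Real.rpow_le_rpow_of_exponent_le hn1 (by norm_num)
        _ = n := Real.rpow_one _
    · intro hfree
      have := pSpectralRadius_le_turanGraph hp.le G (by omega : 0 < r) hfree
      rw [hV] at this
      linarith
    · refine (hdeg u).trans_le (le_of_eq ?_)
      congr!

/-! ### Large codegrees and the Erdős–Stone pigeonhole argument -/

/-- In a graph of large minimum degree, some edge of any `(r + 1)`-clique has many common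
neighbours. -/
theorem exists_edge_large_codegree {V : Type*} [Fintype V] [DecidableEq V] (G : SimpleGraph V)
    [DecidableRel G.Adj] {r : ℕ} {K : Finset V} (hK : G.IsNClique (r + 1) K) {D X : ℝ}
    (hr : 1 ≤ r) (hD : ∀ v, ((Finset.univ.filter fun w => ¬ G.Adj v w).card : ℝ) ≤ D)
    (hX : ((r : ℝ) + 1) * r * X + 2 * (r - 1) * (r + 1) * D <
      Fintype.card V * ((r - 1) * (r + 2))) :
    ∃ u v, G.Adj u v ∧ X ≤ ((Finset.univ.filter fun w => G.Adj u w ∧ G.Adj v w).card : ℝ) := by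
  by_contra! hcon
  have hr1 : (1 : ℝ) ≤ r := by exact_mod_cast hr
  let I : V → V → ℝ := fun v w => if G.Adj v w then 1 else 0
  have hI : ∀ u v, ((Finset.univ.filter fun w => G.Adj u w ∧ G.Adj v w).card : ℝ) =
      ∑ w, I u w * I v w := by
    intro u v
    rw [Finset.card_filter, Nat.cast_sum]
    refine Finset.sum_congr rfl fun w _ => ?_
    by_cases h1 : G.Adj u w <;> by_cases h2 : G.Adj v w <;> simp [I, h1, h2]
  have hKc : (K.card : ℝ) = r + 1 := by rw [hK.card_eq]; push_cast; ring
  have h1 : ∑ u ∈ K, ∑ v ∈ K.erase u, ∑ w, I u w * I v w ≤ ((r : ℝ) + 1) * r * X := by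
    have h2 : ∀ u ∈ K, ∑ v ∈ K.erase u, ∑ w, I u w * I v w ≤ r * X := by
      intro u hu
      have h3 : ((K.erase u).card : ℝ) = r := by
        rw [Finset.card_erase_of_mem hu, hK.card_eq, Nat.add_sub_cancel]
      rw [← h3, ← nsmul_eq_mul]
      refine Finset.sum_le_card_nsmul _ _ _ fun v hv => ?_
      rw [← hI]
      have hv' := Finset.mem_erase.1 hv
      exact (hcon u v (hK.isClique hu hv'.2 hv'.1.symm)).le
    calc _ ≤ (K.card : ℝ) * (r * X) := by
          rw [← nsmul_eq_mul]
          exact Finset.sum_le_card_nsmul _ _ _ h2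
      _ = _ := by rw [hKc]; ring
  let a : V → ℝ := fun w => ∑ v ∈ K, I v w
  have h2 : ∑ u ∈ K, ∑ v ∈ K.erase u, ∑ w, I u w * I v w = ∑ w, (a w ^ 2 - a w) := by
    have h3 : ∀ u ∈ K, ∑ v ∈ K.erase u, ∑ w, I u w * I v w =
        ∑ w, (I u w * a w - I u w) := by
      intro u hu
      rw [Finset.sum_comm]
      refine Finset.sum_congr rfl fun w _ => ?_
      have h4 : I u w * I u w = I u w := by
        by_cases h : G.Adj u w <;> simp [I, h]
      have h5 := Finset.add_sum_erase K (fun v => I u w * I v w) hu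
      simp only [a]
      rw [Finset.mul_sum, ← h5, h4]
      ring
    rw [Finset.sum_congr rfl h3, Finset.sum_comm]
    refine Finset.sum_congr rfl fun w _ => ?_
    rw [Finset.sum_sub_distrib, ← Finset.sum_mul]
    simp only [a]
    ring
  have h3 : ∀ w, ((r : ℝ) - 1) * (r + 2) - 2 * (r - 1) * (r + 1 - a w) ≤ a w ^ 2 - a w := by
    intro w
    have h4 : a w = ((K.filter fun v => G.Adj v w).card : ℝ) := by
      rw [Finset.card_filter, Nat.cast_sum]
      refine Finset.sum_congr rfl fun v _ => ?_
      by_cases h : G.Adj v w <;> simp [I, h]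
    rw [h4]
    set b := (K.filter fun v => G.Adj v w).card
    -- The linear lower bound for b² - b is its secant through r - 1 and r. It holds because b is an
    -- integer.
    have h5 : (0 : ℝ) ≤ ((b : ℝ) - r) * ((b : ℝ) - r + 1) := by
      have : (0 : ℤ) ≤ ((b : ℤ) - r) * ((b : ℤ) - r + 1) := by
        rcases le_or_gt (0 : ℤ) ((b : ℤ) - r) with h | h
        · exact mul_nonneg h (by omega)
        · exact mul_nonneg_of_nonpos_of_nonpos h.le (by omega)
      exact_mod_cast this
    nlinarith
  have h4 : ∑ w, ((r : ℝ) + 1 - a w) ≤ (r + 1) * D := by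
    have h5 : ∀ w, (r : ℝ) + 1 - a w = ∑ v ∈ K, (1 - I v w) := by
      intro w
      rw [Finset.sum_sub_distrib, Finset.sum_const, nsmul_eq_mul, hKc, mul_one]
    simp only [h5]
    rw [Finset.sum_comm, ← hKc, ← nsmul_eq_mul]
    refine Finset.sum_le_card_nsmul _ _ _ fun v _ => ?_
    refine le_trans (le_of_eq ?_) (hD v)
    rw [Finset.card_filter, Nat.cast_sum]
    refine Finset.sum_congr rfl fun w _ => ?_
    by_cases h : G.Adj v w <;> simp [I, h]
  have h5 := Finset.sum_le_sum fun w (_ : w ∈ Finset.univ) => h3 w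
  rw [Finset.sum_sub_distrib, Finset.sum_const, nsmul_eq_mul, Finset.card_univ,
    ← Finset.mul_sum] at h5
  have h6 := mul_le_mul_of_nonneg_left h4 (show (0 : ℝ) ≤ 2 * (r - 1) by linarith)
  rw [h2] at h1
  linarith

/-- One step of the Erdős–Stone pigeonhole argument: adding a part to a complete multipartite
subgraph, at the cost of shrinking its parts. -/
theorem exists_new_part {V : Type*} [Fintype V] [DecidableEq V] (G : SimpleGraph V)
    [DecidableRel G.Adj] {j s m : ℕ} (A : Fin j → Finset V) (hA : ∀ i, (A i).card = m)
    (W : Finset V) {D : ℝ} (hD : ∀ v, ((Finset.univ.filter fun w => ¬ G.Adj v w).card : ℝ) ≤ D)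
    (hsm : s < m) (hW : (j : ℝ) * m * D / (m - s) + s * 2 ^ (m * j) ≤ W.card) :
    ∃ B ⊆ W, B.card = s ∧ ∃ A' : Fin j → Finset V, (∀ i, A' i ⊆ A i ∧ (A' i).card = s) ∧
      ∀ i, ∀ a ∈ A' i, ∀ b ∈ B, G.Adj a b := by
  have hms : (0 : ℝ) < m - s := by
    have : (s : ℝ) < m := by exact_mod_cast hsm
    linarith
  set good := W.filter fun w => ∀ i, s ≤ ((A i).filter fun a => G.Adj a w).card with hgood
  set bad := W.filter fun w => ¬ ∀ i, s ≤ ((A i).filter fun a => G.Adj a w).card with hbad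
  -- Double count of non-adjacent pairs: a bad w misses more than m - s vertices of some part, and
  -- each of the j m vertices misses at most D.
  have hbadcard : (bad.card : ℝ) * (m - s) ≤ j * m * D := by
    have h1 : ∀ w ∈ bad, (m : ℝ) - s ≤
        ∑ i, ∑ a ∈ A i, if ¬ G.Adj a w then (1 : ℝ) else 0 := by
      intro w hw
      have := (Finset.mem_filter.1 hw).2
      push Not at this
      obtain ⟨i, hi⟩ := this
      have h2 : ∑ a ∈ A i, (if ¬ G.Adj a w then (1 : ℝ) else 0) =
          m - ((A i).filter fun a => G.Adj a w).card := by
        have h3 := Finset.card_filter_add_card_filter_not (s := A i) (fun a => G.Adj a w)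
        rw [hA] at h3
        rw [← h3, Finset.card_filter (fun a => ¬ G.Adj a w)]
        push_cast
        ring
      have h4 : ∑ a ∈ A i, (if ¬ G.Adj a w then (1 : ℝ) else 0) ≤
          ∑ i, ∑ a ∈ A i, if ¬ G.Adj a w then (1 : ℝ) else 0 :=
        Finset.single_le_sum (f := fun i => ∑ a ∈ A i, if ¬ G.Adj a w then (1 : ℝ) else 0)
          (fun i _ => Finset.sum_nonneg fun a _ => by split_ifs <;> norm_num) (Finset.mem_univ i)
      have h5 : (((A i).filter fun a => G.Adj a w).card : ℝ) ≤ s := by exact_mod_cast hi.le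
      linarith
    have h2 := Finset.card_nsmul_le_sum bad _ _ h1
    rw [nsmul_eq_mul] at h2
    refine h2.trans ?_
    rw [Finset.sum_comm]
    have h3 : ∀ i ∈ (Finset.univ : Finset (Fin j)),
        ∑ w ∈ bad, ∑ a ∈ A i, (if ¬ G.Adj a w then (1 : ℝ) else 0) ≤ m * D := by
      intro i _
      rw [Finset.sum_comm, ← hA i, ← nsmul_eq_mul]
      refine Finset.sum_le_card_nsmul _ _ _ fun a _ => le_trans ?_ (hD a)
      rw [Finset.card_filter, Nat.cast_sum]
      push_cast
      exact Finset.sum_le_sum_of_subset_of_nonneg (Finset.subset_univ _)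
        fun w _ _ => by split_ifs <;> norm_num
    have h4 := Finset.sum_le_card_nsmul _ _ _ h3
    rw [nsmul_eq_mul, Finset.card_univ, Fintype.card_fin] at h4
    linarith
  have hgoodcard : (2 ^ m) ^ j * s ≤ good.card := by
    have h1 : good.card + bad.card = W.card := Finset.card_filter_add_card_filter_not _
    have h2 : (bad.card : ℝ) ≤ j * m * D / (m - s) := by
      rwa [le_div_iff₀ hms]
    have h3 : (good.card : ℝ) + bad.card = W.card := by exact_mod_cast h1
    have h4 : (s : ℝ) * 2 ^ (m * j) ≤ good.card := by linarith
    rw [← pow_mul, mul_comm]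
    exact_mod_cast h4
  have hchoice : ∀ w, ∃ f : Fin j → Finset V, w ∈ good →
      ∀ i, f i ⊆ (A i).filter (fun a => G.Adj a w) ∧ (f i).card = s := by
    intro w
    by_cases hw : w ∈ good
    · have h1 := (Finset.mem_filter.1 hw).2
      choose f hf using fun i => Finset.exists_subset_card_eq (h1 i)
      exact ⟨f, fun _ => hf⟩
    · exact ⟨fun _ => ∅, fun h => absurd h hw⟩
  choose f hf using hchoice
  have hmaps : ∀ w ∈ good, f w ∈ Fintype.piFinset fun i => (A i).powerset := by
    intro w hw
    rw [Fintype.mem_piFinset]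
    intro i
    rw [Finset.mem_powerset]
    exact ((hf w hw i).1).trans (Finset.filter_subset _ _)
  -- There are at most 2^(m j) patterns of chosen subsets, so s good vertices share one.
  obtain ⟨A', -, hcard⟩ := Finset.exists_le_card_fiber_of_mul_le_card_of_maps_to (n := s) hmaps
    ⟨fun _ => ∅, by simp [Fintype.mem_piFinset]⟩
    (by simpa [Fintype.card_piFinset, Finset.card_powerset, hA] using hgoodcard)
  obtain ⟨B, hB, hBs⟩ := Finset.exists_subset_card_eq hcard
  rcases B.eq_empty_or_nonempty with rfl | ⟨b0, hb0⟩
  · refine ⟨∅, Finset.empty_subset _, hBs, fun _ => ∅, fun i => ⟨Finset.empty_subset _, hBs⟩, ?_⟩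
    intro i a ha
    exact absurd ha (Finset.notMem_empty _)
  have hb : ∀ b ∈ B, b ∈ good ∧ f b = A' := fun b h => Finset.mem_filter.1 (hB h)
  refine ⟨B, fun b h => (Finset.mem_filter.1 (hb b h).1).1, hBs, A', fun i => ?_, ?_⟩
  · obtain ⟨h1, h2⟩ := hb b0 hb0
    have h3 := hf b0 h1 i
    rw [h2] at h3
    exact ⟨h3.1.trans (Finset.filter_subset _ _), h3.2⟩
  · intro i a ha b hbB
    obtain ⟨h1, h2⟩ := hb b hbB
    have h3 := hf b h1 i
    rw [h2] at h3
    exact (Finset.mem_filter.1 (h3.1 ha)).2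

/-- Parts shrink by the factor k, and m/(m - s) = 1 + 1/(k - 1). Half of the surplus g|V| pays for
the term 1/(k - 1), the other half for the pigeonhole. -/
theorem exists_new_part_of_le {V : Type*} [Fintype V] [DecidableEq V] (G : SimpleGraph V)
    [DecidableRel G.Adj] {j s k M : ℕ} (A : Fin j → Finset V) (hA : ∀ i, (A i).card = s * k)
    (W : Finset V) {D g : ℝ}
    (hD : ∀ v, ((Finset.univ.filter fun w => ¬ G.Adj v w).card : ℝ) ≤ D) (hs : 0 < s)
    (hk : 2 ≤ k) (hg : 0 ≤ g) (hgk : 2 ≤ g * (k - 1)) (hjD : j * D + g * Fintype.card V ≤ W.card)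
    (hsM : s ≤ M) (hjM : s * k * j ≤ M * (j + 1))
    (hM : (M : ℝ) * 2 ^ (M * (j + 1)) ≤ g / 2 * Fintype.card V) :
    ∃ B ⊆ W, B.card = s ∧ ∃ A' : Fin j → Finset V, (∀ i, A' i ⊆ A i ∧ (A' i).card = s) ∧
      ∀ i, ∀ a ∈ A' i, ∀ b ∈ B, G.Adj a b := by
  refine exists_new_part G A hA W hD (by nlinarith) ?_
  have hs0 : (0 : ℝ) < s := by exact_mod_cast hs
  have hk1 : (0 : ℝ) < k - 1 := by
    have : (2 : ℝ) ≤ k := by exact_mod_cast hk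
    linarith
  have hWn : (W.card : ℝ) ≤ Fintype.card V := by exact_mod_cast Finset.card_le_univ W
  have h1 : (j : ℝ) * (s * k : ℕ) * D / ((s * k : ℕ) - s) = j * D + j * D / (k - 1) := by
    push_cast
    have : (s : ℝ) * k - s = s * (k - 1) := by ring
    rw [this]
    field_simp
    ring
  have h2 : j * D / (k - 1) ≤ g / 2 * Fintype.card V := by
    rw [div_le_iff₀ hk1]
    have h3 : j * D ≤ Fintype.card V := by
      have : 0 ≤ g * Fintype.card V := by positivity
      linarith
    nlinarith
  have h3 : (s : ℝ) * 2 ^ (s * k * j) ≤ M * 2 ^ (M * (j + 1)) := by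
    have h4 : (s : ℝ) ≤ M := by exact_mod_cast hsM
    exact mul_le_mul h4 (pow_le_pow_right₀ (by norm_num) hjM) (by positivity) (by positivity)
  rw [h1]
  linarith

/-- Greedy construction of a complete `j`-partite subgraph inside a set `U`. -/
theorem exists_complete_parts {V : Type*} [Fintype V] [DecidableEq V] (G : SimpleGraph V)
    [DecidableRel G.Adj] {ρ t k M : ℕ} (U : Finset V) {D g : ℝ}
    (hD : ∀ v, ((Finset.univ.filter fun w => ¬ G.Adj v w).card : ℝ) ≤ D) (hD0 : 0 ≤ D)
    (ht : 0 < t) (hk : 2 ≤ k) (hg : 0 ≤ g) (hgk : 2 ≤ g * (k - 1))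
    (hU : ((ρ : ℝ) - 1) * D + g * Fintype.card V ≤ U.card) (hMt : M = t * k ^ ρ)
    (hM : (M : ℝ) * 2 ^ (M * (ρ + 1)) ≤ g / 2 * Fintype.card V) (j : ℕ) (hj : j ≤ ρ) :
    ∃ A : Fin j → Finset V, (∀ i, A i ⊆ U ∧ (A i).card = t * k ^ (ρ + 1 - j)) ∧
      ∀ i i', i ≠ i' → ∀ a ∈ A i, ∀ a' ∈ A i', G.Adj a a' := by
  induction j with
  | zero => exact ⟨fun _ => ∅, fun i => i.elim0, fun i => i.elim0⟩
  | succ j ih =>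
    -- Each new part costs a factor k in size. The exponent ρ + 1 - j leaves size t k after ρ parts,
    -- enough for one more step outside U.
    obtain ⟨A, hA, hAdj⟩ := ih (by omega)
    have hsplit : t * k ^ (ρ + 1 - j) = t * k ^ (ρ + 1 - (j + 1)) * k := by
      rw [mul_assoc, ← pow_succ]
      congr 2
      omega
    have hjρ : (j : ℝ) ≤ ρ - 1 := by
      have : ((j + 1 : ℕ) : ℝ) ≤ ρ := by exact_mod_cast hj
      push_cast at this
      linarith
    have hsM : t * k ^ (ρ + 1 - (j + 1)) ≤ M := by
      rw [hMt]
      exact Nat.mul_le_mul_left _ (Nat.pow_le_pow_right (by omega) (by omega))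
    have hjM : t * k ^ (ρ + 1 - (j + 1)) * k * j ≤ M * (j + 1) := by
      rcases Nat.eq_zero_or_pos j with rfl | hj0
      · simp
      · rw [← hsplit, hMt]
        exact Nat.mul_le_mul (Nat.mul_le_mul_left _ (Nat.pow_le_pow_right (by omega) (by omega)))
          (by omega)
    have hMj : (M : ℝ) * 2 ^ (M * (j + 1)) ≤ g / 2 * Fintype.card V := by
      refine le_trans ?_ hM
      refine mul_le_mul_of_nonneg_left ?_ (Nat.cast_nonneg _)
      exact pow_le_pow_right₀ (by norm_num) (Nat.mul_le_mul_left _ (by omega))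
    obtain ⟨B, hBU, hBs, A', hA', hAB⟩ := exists_new_part_of_le G (j := j)
      (s := t * k ^ (ρ + 1 - (j + 1))) (k := k) (M := M) A
      (fun i => by rw [(hA i).2, hsplit]) U hD (by positivity) hk hg hgk
      (by
        have := mul_le_mul_of_nonneg_right hjρ hD0
        linarith) hsM hjM hMj
    refine ⟨Fin.cons B A', ?_, ?_⟩
    · intro i
      refine Fin.cases ?_ (fun i => ?_) i
      · simpa only [Fin.cons_zero] using ⟨hBU, hBs⟩
      · simpa only [Fin.cons_succ] using ⟨(hA' i).1.trans (hA i).1, (hA' i).2⟩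
    · intro i i'
      refine Fin.cases ?_ (fun i => ?_) i <;> refine Fin.cases ?_ (fun i' => ?_) i'
      · intro h
        exact absurd rfl h
      · intro _ a ha a' ha'
        simp only [Fin.cons_zero, Fin.cons_succ] at ha ha'
        exact (hAB i' a' ha' a ha).symm
      · intro _ a ha a' ha'
        simp only [Fin.cons_zero, Fin.cons_succ] at ha ha'
        exact hAB i a ha a' ha'
      · intro h a ha a' ha'
        simp only [Fin.cons_succ] at ha ha'
        exact hAdj i i' (fun e => h (by rw [e])) a ((hA' i).1 ha) a' ((hA' i').1 ha')

/-! ### Assembling the multipartite graph and its extra edge -/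

theorem completeEquipartitePlus_isContained {V : Type*} (G : SimpleGraph V) {ρ τ : ℕ}
    (f : Fin (ρ + 1) → Fin (τ + 2) → V) (hinj : ∀ i, Function.Injective (f i))
    (hadj : ∀ i i', i ≠ i' → ∀ a a', G.Adj (f i a) (f i' a')) (h01 : G.Adj (f 0 0) (f 0 1)) :
    (completeEquipartitePlus (ρ + 1) (τ + 2)).IsContained G := by
  have key : ∀ v w : Fin (ρ + 1) × Fin (τ + 2), (v.1 : ℕ) = 0 → (w.1 : ℕ) = 0 → (v.2 : ℕ) = 0 →
      (w.2 : ℕ) = 1 → G.Adj (f v.1 v.2) (f w.1 w.2) := by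
    rintro ⟨i, a⟩ ⟨i', a'⟩ h1 h2 h3 h4
    have e1 : i = 0 := Fin.ext h1
    have e2 : i' = 0 := Fin.ext h2
    have e3 : a = 0 := Fin.ext h3
    have e4 : a' = 1 := Fin.ext (by simpa using h4)
    subst e1 e2 e3 e4
    exact h01
  refine ⟨⟨⟨fun v => f v.1 v.2, ?_⟩, ?_⟩⟩
  · intro v w h
    rw [completeEquipartitePlus, SimpleGraph.sup_adj, SimpleGraph.fromRel_adj] at h
    rcases h with h | ⟨-, h | h⟩
    · exact hadj _ _ (SimpleGraph.completeEquipartiteGraph_adj.1 h) _ _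
    · exact key v w h.1 h.2.1 h.2.2.1 h.2.2.2
    · exact (key w v h.1 h.2.1 h.2.2.1 h.2.2.2).symm
  · rintro ⟨i, a⟩ ⟨i', a'⟩ h
    change f i a = f i' a' at h
    by_cases hi : i = i'
    · subst hi
      rw [hinj i h]
    · exact absurd h (hadj i i' hi a a').ne

/-- A graph of large minimum degree with an edge of large codegree contains a large complete
multipartite graph plus an edge. -/
theorem completeEquipartitePlus_isContained_of_codegree {V : Type*} [Fintype V] [DecidableEq V]
    (G : SimpleGraph V) [DecidableRel G.Adj] {ρ τ k M : ℕ} {D g : ℝ}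
    (hD : ∀ v, ((Finset.univ.filter fun w => ¬ G.Adj v w).card : ℝ) ≤ D) (hD0 : 0 ≤ D)
    (hk : 2 ≤ k) (hg : 0 ≤ g) (hgk : 2 ≤ g * (k - 1)) (hρD : ρ * D + g * Fintype.card V ≤
      Fintype.card V) {u v : V} (huv : G.Adj u v)
    (hU : ((ρ : ℝ) - 1) * D + g * Fintype.card V ≤
      ((Finset.univ.filter fun w => G.Adj u w ∧ G.Adj v w).card : ℝ))
    (hρ : 1 ≤ ρ) (hMt : M = (τ + 2) * k ^ ρ)
    (hM : (M : ℝ) * 2 ^ (M * (ρ + 1)) ≤ g / 2 * Fintype.card V) :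
    (completeEquipartitePlus (ρ + 1) (τ + 2)).IsContained G := by
  obtain ⟨A, hA, hAdj⟩ := exists_complete_parts G (t := τ + 2) _ hD hD0 (by omega) hk hg hgk hU
    hMt hM ρ le_rfl
  have hkk : k ≤ k ^ ρ := Nat.le_self_pow (by omega) k
  have h1k : 1 ≤ k ^ ρ := by omega
  obtain ⟨B, -, hBs, A', hA', hAB⟩ := exists_new_part_of_le G (s := τ + 2) (k := k) (M := M) A
    (fun i => by rw [(hA i).2]; simp) Finset.univ hD (by omega) hk hg hgk
    (by rw [Finset.card_univ]; exact hρD)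
    (by rw [hMt]; exact Nat.le_mul_of_pos_right _ h1k)
    (by rw [hMt]; exact Nat.mul_le_mul (Nat.mul_le_mul_left _ hkk) (by omega)) hM
  have hA'uv : ∀ i, ∀ a ∈ A' i, G.Adj u a ∧ G.Adj v a := fun i a ha =>
    (Finset.mem_filter.1 ((hA i).1 ((hA' i).1 ha))).2
  -- The first part will be u, v and τ further vertices of B. As B may contain u or v, both are
  -- erased first.
  have hC : τ ≤ ((B.erase u).erase v).card := by
    have h1 := Finset.pred_card_le_card_erase (s := B) (a := u)
    have h2 := Finset.pred_card_le_card_erase (s := B.erase u) (a := v)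
    omega
  obtain ⟨C, hCB, hCc⟩ := Finset.exists_subset_card_eq hC
  have hCmem : ∀ c ∈ C, c ∈ B ∧ c ≠ u ∧ c ≠ v := by
    intro c hc
    have := hCB hc
    simp only [Finset.mem_erase] at this
    exact ⟨this.2.2, this.2.1, this.1⟩
  let e : Fin τ → V := fun i => ((Finset.equivFinOfCardEq hCc).symm i : V)
  have he : ∀ i, e i ∈ C := fun i => ((Finset.equivFinOfCardEq hCc).symm i).2
  have heinj : Function.Injective e :=
    Subtype.val_injective.comp (Finset.equivFinOfCardEq hCc).symm.injective
  let f0 : Fin (τ + 2) → V := Fin.cons u (Fin.cons v e : Fin (τ + 1) → V)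
  have hf0inj : Function.Injective f0 := by
    refine Fin.cons_injective_iff.2 ⟨?_, Fin.cons_injective_iff.2 ⟨?_, heinj⟩⟩
    · rintro ⟨i, hi⟩
      revert hi
      refine Fin.cases ?_ (fun i => ?_) i
      · rw [Fin.cons_zero]
        exact huv.ne'
      · rw [Fin.cons_succ]
        exact (hCmem _ (he i)).2.1
    · rintro ⟨i, hi⟩
      exact (hCmem _ (he i)).2.2 hi
  have hf0adj : ∀ x i, ∀ a ∈ A' i, G.Adj (f0 x) a := by
    intro x i a ha
    refine Fin.cases ?_ (fun x => Fin.cases ?_ (fun x => ?_) x) x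
    · exact (hA'uv i a ha).1
    · exact (hA'uv i a ha).2
    · exact (hAB i a ha _ (hCmem _ (he x)).1).symm
  let fi : Fin ρ → Fin (τ + 2) → V := fun i x =>
    ((Finset.equivFinOfCardEq (hA' i).2).symm x : V)
  have hfi : ∀ i x, fi i x ∈ A' i := fun i x => ((Finset.equivFinOfCardEq (hA' i).2).symm x).2
  refine completeEquipartitePlus_isContained G (Fin.cons f0 fi : Fin (ρ + 1) → Fin (τ + 2) → V)
    ?_ ?_ huv
  · intro i
    refine Fin.cases ?_ (fun i => ?_) i
    · exact hf0inj
    · exact Subtype.val_injective.comp (Finset.equivFinOfCardEq (hA' i).2).symm.injective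
  · intro i i'
    refine Fin.cases ?_ (fun i => ?_) i <;> refine Fin.cases ?_ (fun i' => ?_) i'
    · intro h
      exact absurd rfl h
    · intro _ a a'
      exact hf0adj a i' _ (hfi i' a')
    · intro _ a a'
      exact (hf0adj a' i _ (hfi i a)).symm
    · intro h a a'
      exact hAdj i i' (fun e => h (by rw [e])) _ ((hA' i).1 (hfi i a)) _ ((hA' i').1 (hfi i' a'))

/-- A graph with a clique on `r + 1` vertices and minimum degree above
`(1 - 1 / r - 1 / r ^ 6) * |V|` contains a large complete `r`-partite graph plus an edge. -/
theorem completeEquipartitePlus_isContained_of_degree {V : Type*} [Fintype V] {r t : ℕ}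
    (hr : 2 ≤ r) (ht : 2 ≤ t) (G : SimpleGraph V) [DecidableRel G.Adj]
    (hG : ¬ G.CliqueFree (r + 1))
    (hdeg : ∀ u, (1 - 1 / (r : ℝ) - 1 / (r : ℝ) ^ 6) * Fintype.card V <
      ((Finset.univ.filter fun j => G.Adj u j).card : ℝ))
    (hV : (2 : ℝ) ^ (2 * (t * r ^ (5 * r))) * (2 * (r : ℝ) ^ 3) ≤ Fintype.card V) :
    (completeEquipartitePlus r t).IsContained G := by
  classical
  obtain ⟨ρ, rfl⟩ : ∃ ρ, r = ρ + 1 := ⟨r - 1, by omega⟩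
  obtain ⟨τ, rfl⟩ : ∃ τ, t = τ + 2 := ⟨t - 2, by omega⟩
  have hρr : (ρ : ℝ) = ((ρ + 1 : ℕ) : ℝ) - 1 := by push_cast; ring
  have hr2 : (2 : ℝ) ≤ ((ρ + 1 : ℕ) : ℝ) := by exact_mod_cast hr
  set x : ℝ := ((ρ + 1 : ℕ) : ℝ) with hx
  have hx0 : 0 < x := by linarith
  have hm0 : (0 : ℝ) < Fintype.card V := lt_of_lt_of_le (by positivity) hV
  set m : ℝ := (Fintype.card V : ℝ) with hm
  have hx1 : 2 * x ≤ x ^ 2 := by nlinarith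
  have hx2 : 2 * x ^ 2 ≤ x ^ 3 := by
    have := mul_le_mul_of_nonneg_right hr2 (show 0 ≤ x ^ 2 by positivity)
    calc _ ≤ x * x ^ 2 := this
      _ = _ := by ring
  have hx3 : 2 * x ^ 3 ≤ x ^ 4 := by
    have := mul_le_mul_of_nonneg_right hr2 (show 0 ≤ x ^ 3 by positivity)
    calc _ ≤ x * x ^ 3 := this
      _ = _ := by ring
  have hx4 : 2 * x ^ 4 ≤ x ^ 5 := by
    have := mul_le_mul_of_nonneg_right hr2 (show 0 ≤ x ^ 4 by positivity)
    calc _ ≤ x * x ^ 4 := this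
      _ = _ := by ring
  have hD : ∀ v, ((Finset.univ.filter fun w => ¬ G.Adj v w).card : ℝ) ≤
      (1 / x + 1 / x ^ 6) * m := by
    intro v
    have h1 := Finset.card_filter_add_card_filter_not (s := Finset.univ) (fun w => G.Adj v w)
    rw [Finset.card_univ] at h1
    have h2 : ((Finset.univ.filter fun w => G.Adj v w).card : ℝ) +
        ((Finset.univ.filter fun w => ¬ G.Adj v w).card : ℝ) = m := by
      rw [hm]
      exact_mod_cast h1
    have h3 := hdeg v
    linarith
  have hD0 : 0 ≤ (1 / x + 1 / x ^ 6) * m := by positivity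
  obtain ⟨K, hK⟩ : ∃ K, G.IsNClique (ρ + 1 + 1) K := by
    by_contra! h
    exact hG h
  -- For D = m/r the averaging reaches (r - 2)m/r + 2m/(r²(r + 1)). Asking only for a surplus m/r³
  -- leaves room for the r^(-6) term in D.
  obtain ⟨u, v, huv, hX⟩ := exists_edge_large_codegree G hK
    (X := ((ρ : ℝ) - 1) * ((1 / x + 1 / x ^ 6) * m) + 1 / x ^ 3 * m) (by omega) hD (by
      rw [← hx, ← hm, hρr]
      have e : (x + 1) * x * ((x - 1 - 1) * ((1 / x + 1 / x ^ 6) * m) + 1 / x ^ 3 * m) +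
          2 * (x - 1) * (x + 1) * ((1 / x + 1 / x ^ 6) * m) =
          m * (((x + 1) * (x ^ 2 - 2) * (x ^ 5 + 1) + (x + 1) * x ^ 4) / x ^ 6) := by
        field_simp
        ring
      rw [e]
      refine mul_lt_mul_of_pos_left ?_ hm0
      rw [div_lt_iff₀ (by positivity)]
      nlinarith)
  -- With g = 1/r³, the choice k = r^5 gives g(k - 1) = r² - 1/r³ ≥ 2.
  refine completeEquipartitePlus_isContained_of_codegree G (k := (ρ + 1) ^ 5) (g := 1 / x ^ 3)
    (M := (τ + 2) * ((ρ + 1) ^ 5) ^ ρ) hD hD0 ?_ (by positivity) ?_ ?_ huv hX (by omega) rfl ?_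
  · exact hr.trans (Nat.le_self_pow (by norm_num) _)
  · rw [Nat.cast_pow, ← hx, one_div, ← div_eq_inv_mul, le_div_iff₀ (by positivity)]
    linarith
  · rw [← hm, hρr]
    have e : (x - 1) * ((1 / x + 1 / x ^ 6) * m) + 1 / x ^ 3 * m =
        m * (((x - 1) * (x ^ 5 + 1) + x ^ 3) / x ^ 6) := by
      field_simp
    rw [e]
    refine mul_le_of_le_one_right hm0.le ?_
    rw [div_le_one (by positivity)]
    nlinarith
  · set M := (τ + 2) * ((ρ + 1) ^ 5) ^ ρ with hM
    have h1 : M * (ρ + 1) ≤ (τ + 2) * (ρ + 1) ^ (5 * (ρ + 1)) := by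
      rw [hM, mul_assoc, ← pow_mul, ← pow_succ]
      exact Nat.mul_le_mul_left _ (Nat.pow_le_pow_right (by omega) (by omega))
    have h2 : M * 2 ^ (M * (ρ + 1)) ≤ 2 ^ (2 * ((τ + 2) * (ρ + 1) ^ (5 * (ρ + 1)))) := by
      calc M * 2 ^ (M * (ρ + 1)) ≤ 2 ^ M * 2 ^ (M * (ρ + 1)) :=
            Nat.mul_le_mul_right _ Nat.lt_two_pow_self.le
        _ = 2 ^ (M + M * (ρ + 1)) := (pow_add _ _ _).symm
        _ ≤ _ := Nat.pow_le_pow_right (by norm_num) (by nlinarith)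
    have h3 : (M : ℝ) * 2 ^ (M * (ρ + 1)) ≤
        (2 : ℝ) ^ (2 * ((τ + 2) * (ρ + 1) ^ (5 * (ρ + 1)))) := by exact_mod_cast h2
    have h4 : 1 / x ^ 3 / 2 * m = m / (2 * x ^ 3) := by
      field_simp
    rw [← hm, h4, le_div_iff₀ (by positivity)]
    exact (mul_le_mul_of_nonneg_right h3 (by positivity)).trans hV

/-! ### Choice of constants -/

theorem theorem6 (r n : ℕ) (p c : ℝ) (hr : 2 ≤ r) (hp : 1 < p) (hc : 0 < c)
    (hcr : c ≤ (r : ℝ) ^ (-(((r : ℝ) + 8) * r)) / 2)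
    (hn : 2 * p / (c * p - c) ≤ Real.log n)
    {V : Type*} [Fintype V] (G : SimpleGraph V) (hV : Fintype.card V = n)
    (hG : pSpectralRadius p (SimpleGraph.turanGraph n r) < pSpectralRadius p G) :
    (completeEquipartitePlus r ⌊c * Real.log n⌋₊).IsContained G := by
  classical
  have hr2 : (2 : ℝ) ≤ r := by exact_mod_cast hr
  have hr0 : (0 : ℝ) < r := by linarith
  have hr1 : (1 : ℝ) ≤ r := by linarith
  have hcp : 0 < c * (p - 1) := mul_pos hc (by linarith)
  set l := Real.log n with hl
  have hl1 : 2 * p ≤ c * (p - 1) * l := by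
    rw [div_le_iff₀ (by linarith)] at hn
    linarith
  have hl0 : 0 < l := by
    by_contra! h
    have := mul_nonpos_of_nonneg_of_nonpos hcp.le h
    linarith
  have hn0 : 0 < n := by
    rcases Nat.eq_zero_or_pos n with h | h
    · rw [hl, h] at hl0
      simp at hl0
    · exact h
  have hn0' : (0 : ℝ) < n := by exact_mod_cast hn0
  have hcpow : ∀ e : ℕ, e ≤ (r + 8) * r → c * (r : ℝ) ^ e ≤ 1 / 2 := by
    intro e he
    have h1 : (r : ℝ) ^ (-(((r : ℝ) + 8) * r)) = ((r : ℝ) ^ ((r + 8) * r))⁻¹ := by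
      rw [Real.rpow_neg hr0.le, ← Real.rpow_natCast]
      push_cast
      rfl
    have h2 : (r : ℝ) ^ e ≤ (r : ℝ) ^ ((r + 8) * r) := pow_le_pow_right₀ hr1 he
    rw [h1] at hcr
    calc c * (r : ℝ) ^ e ≤ ((r : ℝ) ^ ((r + 8) * r))⁻¹ / 2 * (r : ℝ) ^ ((r + 8) * r) :=
          mul_le_mul hcr h2 (by positivity) (by positivity)
      _ = 1 / 2 := by field_simp
  -- Here (r + 8) r ≥ 20, with equality at r = 2.
  have hc20 := hcpow 20 (by nlinarith)
  have hc5 : c * (r : ℝ) ^ (5 * r) ≤ 1 / 8 := by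
    have h1 := hcpow (5 * r + 2) (by nlinarith)
    rw [pow_add] at h1
    have h2 : (4 : ℝ) ≤ (r : ℝ) ^ 2 := by nlinarith
    have h3 := mul_le_mul_of_nonneg_left h2 (show 0 ≤ c * (r : ℝ) ^ (5 * r) by positivity)
    linarith
  have hlog : 8 * (r : ℝ) ^ 20 ≤ (2 - 2 / p) * l := by
    have h1 : (2 - 2 / p) * l = 2 * ((p - 1) * l) / p := by
      field_simp
    rw [h1, le_div_iff₀ (by linarith)]
    have h2 : c * (4 * (r : ℝ) ^ 20 * p) ≤ c * ((p - 1) * l) := by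
      have := mul_le_mul_of_nonneg_right hc20 (show 0 ≤ 4 * p by linarith)
      linarith
    have := le_of_mul_le_mul_left h2 hc
    linarith
  have ht : 2 ≤ ⌊c * l⌋₊ := by
    refine Nat.le_floor ?_
    have h1 : (p - 1) * 2 ≤ (p - 1) * (c * l) := by linarith
    have := le_of_mul_le_mul_left h1 (by linarith)
    exact_mod_cast this
  obtain ⟨W, _, H, hHG, hW, hclique, hdeg⟩ :=
    exists_contained_clique_large_degrees hp hr hn0 hlog G hV hG
  refine (completeEquipartitePlus_isContained_of_degree hr ht H hclique hdeg ?_).trans hHG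
  have htl : (⌊c * l⌋₊ : ℝ) ≤ c * l := Nat.floor_le (mul_pos hc hl0).le
  have h2exp : (2 : ℝ) ≤ Real.exp 1 := by
    have := Real.add_one_le_exp (1 : ℝ)
    linarith
  have h1 : (2 : ℝ) ^ (2 * (⌊c * l⌋₊ * r ^ (5 * r))) ≤ Real.exp (l / 4) := by
    refine (pow_le_pow_left₀ (by norm_num) h2exp _).trans ?_
    rw [← Real.exp_nat_mul, mul_one]
    refine Real.exp_le_exp.2 ?_
    push_cast
    calc 2 * ((⌊c * l⌋₊ : ℝ) * (r : ℝ) ^ (5 * r)) ≤ 2 * (c * l * (r : ℝ) ^ (5 * r)) := by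
          gcongr
      _ = 2 * l * (c * (r : ℝ) ^ (5 * r)) := by ring
      _ ≤ 2 * l * (1 / 8) := by gcongr
      _ = l / 4 := by ring
  have h2 : 2 * (r : ℝ) ^ 3 ≤ Real.exp (l / 4) := by
    have h3 : (r : ℝ) ^ 3 ≤ (r : ℝ) ^ 20 := pow_le_pow_right₀ hr1 (by norm_num)
    have h4 : (2 - 2 / p) * l ≤ 2 * l :=
      mul_le_mul_of_nonneg_right (by have : 0 < 2 / p := by positivity
                                     linarith) hl0.le
    have h5 := Real.add_one_le_exp (l / 4)
    have h6 : 8 ≤ (r : ℝ) ^ 3 := by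
      have := pow_le_pow_left₀ (by norm_num) hr2 3
      linarith
    have h7 : (r : ℝ) ^ 3 * 8 ≤ (r : ℝ) ^ 20 := by
      calc (r : ℝ) ^ 3 * 8 ≤ (r : ℝ) ^ 3 * (r : ℝ) ^ 3 := by gcongr
        _ = (r : ℝ) ^ 6 := by ring
        _ ≤ _ := pow_le_pow_right₀ hr1 (by norm_num)
    linarith
  -- The order √n of H is split evenly: one factor n^(1/4) covers the pigeonhole term, the other
  -- covers 2 r³.
  calc _ ≤ Real.exp (l / 4) * Real.exp (l / 4) :=
        mul_le_mul h1 h2 (by positivity) (Real.exp_pos _).le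
    _ = (n : ℝ) ^ (1 / 2 : ℝ) := by
        rw [← Real.exp_add, Real.rpow_def_of_pos hn0', ← hl]
        congr 1
        ring
    _ ≤ _ := hW
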